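/- All registers are finite-dimensional, $\log$ is to base $2$, $[x]=\{1,\dots,\lfloor x\rfloor\}$, and a missing register in the subscript of a state denotes a partial trace. For states $\rho,\sigma$ and $\varepsilon\in(0,1)$ let $$\mathrm{D}_{\mathrm H}^{\varepsilon}(\rho\|\sigma)=\sup_{0\preceq\Lambda\preceq I,\ \mathrm{Tr}(\Lambda\rho)\ge 1-\varepsilon}\log\frac{1}{\mathrm{Tr}(\Lambda\sigma)}.$$ An $(R_1,R_2,\eta_1,\eta_2)$-entanglement-assisted code for a quantum channel (completely positive trace-preserving map) $\mathcal N_{AB\to C}$ consists of a pure state shared by Alice and Charlie on registers $E_AE_{C_1}$, a pure state shared by Bob and Charlie on registers $E_BE_{C_2}$, encoding channels $\mathcal E_1:M_1E_A\to A$ and $\mathcal E_2:M_2E_B\to B$, and a decoding channel $\mathcal D:E_{C_1}E_{C_2}C\to M_1'M_2'$, such that whenever $(m_1,m_2)\in[2^{R_1}]\times[2^{R_2}]$ is sent, the output of Charlie satisfies $\Pr(M_1'\ne m_1)\le\eta_1$ and $\Pr(M_2'\ne m_2)\le\eta_2$. **Theorem.** Fix a quantum channel $\mathcal N_{AB\to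 C}$ and $\varepsilon_1,\varepsilon_2,\delta\in(0,1)$. Let $\psi_{AA'A''BB'B''}$ be a quantum state with $\psi_{AA'A''BB'B''}=\psi_{AA'A''}\otimes\psi_{BB'B''}$ and $\psi_{A'A''B'B''}=\psi_{A'}\otimes\psi_{A''}\otimes\psi_{B'}\otimes\psi_{B''}$, and let $\rho_{CA'A''B'B''}=\mathcal N_{AB\to C}(\psi_{AA'A''BB'B''})$. Let $R_1,R_2\ge 0$ satisfy $$R_1\le \mathrm{D}_{\mathrm H}^{\varepsilon_1}(\rho_{A'CA''B''}\,\|\,\rho_{A'}\otimes\rho_{CA''B''})-\log\frac1\delta,\qquad R_2\le \mathrm{D}_{\mathrm H}^{\varepsilon_2}(\rho_{B'CA''B''}\,\|\,\rho_{B'}\otimes\rho_{CA''B''})-\log\frac1\delta .$$ Then there is an $(R_1,R_2,4(\varepsilon_1+\varepsilon_2+2\delta),4(\varepsilon_1+\varepsilon_2+2\delta))$-entanglement-assisted code for $\mathcal N_{AB\to C}$ whose joint decoding error satisfies, for all $(m_1,m_2)\in[2^{R_1}]\times[2^{R_2}]$, $$\Pr\big((M_1',M_2')\ne(m_1,m_2)\,\big|\,(M_1,M_2)=(m_1,m_2)\big)\le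 4(\varepsilon_1+\varepsilon_2+2\delta).$$ Moreover, the decoder of this code can be taken to be sequential and position-based: Charlie's shares are $E_{C_1}=A'_1\cdots A'_{\lfloor 2^{R_1}\rfloor}A''$ and $E_{C_2}=B'_1\cdots B'_{\lfloor 2^{R_2}\rfloor}B''$ (copies of $A'$, $A''$, $B'$, $B''$); he adds an ancilla $J$ in a fixed pure state; there are a projector $\Pi_1$ on $A'CA''B''J$ and a projector $\Pi_2$ on $B'CA''B''J$ such that he measures $\{\Pi_1,I-\Pi_1\}$ on $A'_iCA''B''J$ for $i=1,2,\dots,\lfloor 2^{R_1}\rfloor$ in turn, and then $\{\Pi_2,I-\Pi_2\}$ on $B'_iCA''B''J$ for $i=1,2,\dots,\lfloor 2^{R_2}\rfloor$ in turn; and he outputs as $(m_1',m_2')$ the first index of each of the two rounds whose outcome is $\Pi_1$, respectively $\Pi_2$ (some fixed index if there is none). -/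

import Mathlib

open scoped Kronecker Matrix ComplexOrder

universe u v w

noncomputable section

namespace QMAC

/-! Finite-dimensional quantum registers. A register is given by a finite type `X` labelling an
orthonormal basis of its Hilbert space; operators on it are the matrices `Matrix X X ℂ`, the
composition of two registers is the product type, and the tensor product of operators is the
Kronecker product. -/

/-- Density matrices. -/
def IsState {X : Type u} [Fintype X] (ρ : Matrix X X ℂ) : Prop :=
  ρ.PosSemidef ∧ ρ.trace = 1

/-- `(N ⊗ id)(ρ)`: the map `N` applied to the first of two registers. -/
def applyFst {X : Type u} {Y : Type v} {Z : Type w}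
    (N : Matrix X X ℂ →ₗ[ℂ] Matrix Y Y ℂ) (ρ : Matrix (X × Z) (X × Z) ℂ) :
    Matrix (Y × Z) (Y × Z) ℂ :=
  Matrix.of fun i j => N (Matrix.of fun x x' => ρ (x, i.2) (x', j.2)) i.1 j.1

/-- Quantum channels: completely positive and trace preserving linear maps. -/
structure IsChannel {X : Type u} {Y : Type v} [Fintype X] [Fintype Y]
    (N : Matrix X X ℂ →ₗ[ℂ] Matrix Y Y ℂ) : Prop where
  completelyPositive : ∀ (n : ℕ) (ρ : Matrix (X × Fin n) (X × Fin n) ℂ),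
    ρ.PosSemidef → (applyFst N ρ).PosSemidef
  tracePreserving : ∀ ρ : Matrix X X ℂ, (N ρ).trace = ρ.trace

/-- General partial trace: `f y z` is the basis label of the whole system whose kept part is `y`
and whose discarded part is `z`. -/
def marginal {X : Type u} {Y : Type v} {Z : Type w} [Fintype Z] (f : Y → Z → X)
    (ρ : Matrix X X ℂ) : Matrix Y Y ℂ :=
  Matrix.of fun y y' => ∑ z, ρ (f y z) (f y' z)

/-- The marginal on the first register. -/
def margFst {Y : Type u} {Z : Type v} [Fintype Z] (ρ : Matrix (Y × Z) (Y × Z) ℂ) :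
    Matrix Y Y ℂ :=
  marginal (fun y z => (y, z)) ρ

/-- The marginal on the second register. -/
def margSnd {Y : Type u} {Z : Type v} [Fintype Y] (ρ : Matrix (Y × Z) (Y × Z) ℂ) :
    Matrix Z Z ℂ :=
  marginal (fun z y => (y, z)) ρ

/-- `log₂ (1 / x)` for `x ≥ 0`, with value `+∞` at `x = 0`. -/
def logInv (x : ℝ) : EReal :=
  if x ≤ 0 then ⊤ else ((Real.logb 2 (1 / x) : ℝ) : EReal)

/-- The smooth quantum hypothesis testing divergence `D_H^ε(ρ ‖ σ)`: the supremum of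
`log₂ (1 / Tr(Λσ))` over `0 ≤ Λ ≤ 1` with `Tr(Λρ) ≥ 1 - ε`. -/
def hypTestDiv {X : Type u} [Fintype X] [DecidableEq X] (ε : ℝ) (ρ σ : Matrix X X ℂ) : EReal :=
  ⨆ (Λ : Matrix X X ℂ) (_ : Λ.PosSemidef ∧ (1 - Λ).PosSemidef ∧ 1 - ε ≤ (Λ * ρ).trace.re),
    logInv (Λ * σ).trace.re

/-! Entanglement-assisted codes for a multiple-access channel `AB → C`. -/

/-- An entanglement-assisted code for two senders, with input registers `A`, `B`, and one receiver,
with register `C`, for messages `m₁ ∈ [M₁]` and `m₂ ∈ [M₂]`. -/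
structure EACode (A B C : Type u) [Fintype A] [Fintype B] [Fintype C] (M₁ M₂ : ℕ) where
  /-- first sender's half of the entanglement -/
  EA : Type u
  /-- the receiver's half of the entanglement shared with the first sender -/
  EC₁ : Type u
  /-- second sender's half of the entanglement -/
  EB : Type u
  /-- the receiver's half of the entanglement shared with the second sender -/
  EC₂ : Type u
  fintypeEA : Fintype EA
  fintypeEC₁ : Fintype EC₁
  fintypeEB : Fintype EB
  fintypeEC₂ : Fintype EC₂
  /-- the pure state shared by the first sender and the receiver -/
  θ₁ : EA × EC₁ → ℂ
  /-- the pure state shared by the second sender and the receiver -/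
  θ₂ : EB × EC₂ → ℂ
  θ₁_unit : ∑ i, ‖θ₁ i‖ ^ 2 = 1
  θ₂_unit : ∑ i, ‖θ₂ i‖ ^ 2 = 1
  /-- the encoding operation of the first sender -/
  enc₁ : Matrix (Fin M₁ × EA) (Fin M₁ × EA) ℂ →ₗ[ℂ] Matrix A A ℂ
  /-- the encoding operation of the second sender -/
  enc₂ : Matrix (Fin M₂ × EB) (Fin M₂ × EB) ℂ →ₗ[ℂ] Matrix B B ℂ
  /-- the decoding operation of the receiver -/
  dec : Matrix (C × (EC₁ × EC₂)) (C × (EC₁ × EC₂)) ℂ →ₗ[ℂ]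
    Matrix (Fin M₁ × Fin M₂) (Fin M₁ × Fin M₂) ℂ
  enc₁_channel : IsChannel enc₁
  enc₂_channel : IsChannel enc₂
  dec_channel : IsChannel dec

attribute [instance] EACode.fintypeEA EACode.fintypeEC₁ EACode.fintypeEB EACode.fintypeEC₂

/-- The state on `A E_C` after a sender, who shares the pure state `θ` on `E E_C` with the receiver,
has applied the encoding operation to `|m⟩⟨m|` and to the register `E`. -/
def encoded {A E EC : Type u} {M : ℕ}
    (enc : Matrix (Fin M × E) (Fin M × E) ℂ →ₗ[ℂ] Matrix A A ℂ) (θ : E × EC → ℂ) (m : Fin M) :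
    Matrix (A × EC) (A × EC) ℂ :=
  applyFst enc (Matrix.reindex (Equiv.prodAssoc _ _ _).symm (Equiv.prodAssoc _ _ _).symm
    (Matrix.single m m (1 : ℂ) ⊗ₖ Matrix.vecMulVec θ (star θ)))

namespace EACode

variable {A B C : Type u} [Fintype A] [Fintype B] [Fintype C] {M₁ M₂ : ℕ}

/-- The receiver's state after the transmission of the messages `(m₁, m₂)` over `N`. -/
def received (code : EACode A B C M₁ M₂) (N : Matrix (A × B) (A × B) ℂ →ₗ[ℂ] Matrix C C ℂ)
    (m : Fin M₁ × Fin M₂) : Matrix (C × (code.EC₁ × code.EC₂)) (C × (code.EC₁ × code.EC₂)) ℂ :=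
  applyFst N (Matrix.reindex (Equiv.prodProdProdComm _ _ _ _) (Equiv.prodProdProdComm _ _ _ _)
    (encoded code.enc₁ code.θ₁ m.1 ⊗ₖ encoded code.enc₂ code.θ₂ m.2))

/-- The probability that the receiver outputs `m' = (m'₁, m'₂)` when `m = (m₁, m₂)` is sent. -/
def outcomeProb (code : EACode A B C M₁ M₂)
    (N : Matrix (A × B) (A × B) ℂ →ₗ[ℂ] Matrix C C ℂ) (m m' : Fin M₁ × Fin M₂) : ℝ :=
  (code.dec (code.received N m) m' m').re

/-- The error conditions `Pr(M'₁ ≠ m₁ | m₁, m₂) ≤ e₁` and `Pr(M'₂ ≠ m₂ | m₁, m₂) ≤ e₂`, for every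
pair of messages. -/
def HasErrors (code : EACode A B C M₁ M₂)
    (N : Matrix (A × B) (A × B) ℂ →ₗ[ℂ] Matrix C C ℂ) (e₁ e₂ : ℝ) : Prop :=
  ∀ m : Fin M₁ × Fin M₂,
    ∑ m' with m'.1 ≠ m.1, code.outcomeProb N m m' ≤ e₁ ∧
    ∑ m' with m'.2 ≠ m.2, code.outcomeProb N m m' ≤ e₂

/-- The probability `Pr((M'₁, M'₂) ≠ (m₁, m₂) | m₁, m₂)` of the joint decoding error. -/
def jointError (code : EACode A B C M₁ M₂)
    (N : Matrix (A × B) (A × B) ℂ →ₗ[ℂ] Matrix C C ℂ) (m : Fin M₁ × Fin M₂) : ℝ :=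
  ∑ m' with m' ≠ m, code.outcomeProb N m m'

end EACode

/-! Sequential position-based decoding. -/

/-- The Kraus operator of measuring `{P 0, 1 - P 0}`, then `{P 1, 1 - P 1}`, and so on, with
outcomes `s` (`true` stands for `P i`): the last measurement is the leftmost factor. -/
def seqOp {X : Type u} [Fintype X] [DecidableEq X] {M : ℕ} (P : Fin M → Matrix X X ℂ)
    (s : Fin M → Bool) : Matrix X X ℂ :=
  (List.ofFn fun i => if s i then P i else 1 - P i).reverse.prod

/-- The first `i` with outcome `true`, and `d` if there is none. -/
def firstYes {M : ℕ} (d : Fin M) (s : Fin M → Bool) : Fin M :=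
  ((List.finRange M).find? s).getD d

/-- Sequential decoding: the ancilla `J` is added in the state `|j₀⟩`, the tests `P 0, P 1, …` are
measured one after the other and then the tests `Q 0, Q 1, …`; the output is the pair of the first
positive test of each family (`d₁`, `d₂` where there is none). -/
def seqDecode {K : Type u} {J : Type v} [Fintype K] [DecidableEq K] [Fintype J] [DecidableEq J]
    {M₁ M₂ : ℕ} (j₀ : J) (P : Fin M₁ → Matrix (K × J) (K × J) ℂ)
    (Q : Fin M₂ → Matrix (K × J) (K × J) ℂ) (d₁ : Fin M₁) (d₂ : Fin M₂) (X : Matrix K K ℂ) :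
    Matrix (Fin M₁ × Fin M₂) (Fin M₁ × Fin M₂) ℂ :=
  Matrix.diagonal fun m' =>
    ∑ s : (Fin M₁ → Bool) × (Fin M₂ → Bool) with (firstYes d₁ s.1, firstYes d₂ s.2) = m',
      ((seqOp Q s.2 * seqOp P s.1) * (X ⊗ₖ Matrix.single j₀ j₀ (1 : ℂ)) *
        (seqOp Q s.2 * seqOp P s.1)ᴴ).trace

/-- The receiver's registers in a position-based code: `C`, together with `M₁` copies of `A'` and
one `A''`, and `M₂` copies of `B'` and one `B''`. -/
abbrev PosReg (C A' A'' B' B'' : Type u) (M₁ M₂ : ℕ) : Type u :=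
  C × (((Fin M₁ → A') × A'') × ((Fin M₂ → B') × B''))

/-- The operator `T` acting on `A'_{m} C A'' B'' J`, and trivially on all other copies. -/
def posTest₁ {C A' A'' B' B'' J : Type u} [DecidableEq A'] [DecidableEq B'] {M₁ M₂ : ℕ}
    (T : Matrix ((A' × (C × A'' × B'')) × J) ((A' × (C × A'' × B'')) × J) ℂ) (m : Fin M₁) :
    Matrix (PosReg C A' A'' B' B'' M₁ M₂ × J) (PosReg C A' A'' B' B'' M₁ M₂ × J) ℂ :=
  Matrix.of fun ((c, (a', a''), (b', b'')), j) ((k, (p', p''), (q', q'')), l) =>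
    if (∀ i, i ≠ m → a' i = p' i) ∧ b' = q' then
      T ((a' m, (c, a'', b'')), j) ((p' m, (k, p'', q'')), l)
    else 0

/-- The operator `T` acting on `B'_{m} C A'' B'' J`, and trivially on all other copies. -/
def posTest₂ {C A' A'' B' B'' J : Type u} [DecidableEq A'] [DecidableEq B'] {M₁ M₂ : ℕ}
    (T : Matrix ((B' × (C × A'' × B'')) × J) ((B' × (C × A'' × B'')) × J) ℂ) (m : Fin M₂) :
    Matrix (PosReg C A' A'' B' B'' M₁ M₂ × J) (PosReg C A' A'' B' B'' M₁ M₂ × J) ℂ :=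
  Matrix.of fun ((c, (a', a''), (b', b'')), j) ((k, (p', p''), (q', q'')), l) =>
    if a' = p' ∧ (∀ i, i ≠ m → b' i = q' i) then
      T ((b' m, (c, a'', b'')), j) ((q' m, (k, p'', q'')), l)
    else 0

/-- The receiver holds `M₁` copies of `A'`, one `A''`, `M₂` copies of `B'` and one `B''`, and decodes
sequentially with one projector `T₁` on `A' C A'' B'' J`, applied with the copies of `A'` in turn,
and then one projector `T₂` on `B' C A'' B'' J`, applied with the copies of `B'` in turn. -/
def EACode.IsSequentialPositionBased {A B C : Type u} [Fintype A] [Fintype B] [Fintype C]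
    [DecidableEq C] {M₁ M₂ : ℕ} (code : EACode A B C M₁ M₂) (A' A'' B' B'' : Type u)
    [Fintype A'] [DecidableEq A'] [Fintype A''] [DecidableEq A'']
    [Fintype B'] [DecidableEq B'] [Fintype B''] [DecidableEq B''] : Prop :=
  ∃ (e₁ : code.EC₁ ≃ (Fin M₁ → A') × A'') (e₂ : code.EC₂ ≃ (Fin M₂ → B') × B'')
    (J : Type u) (_ : Fintype J) (_ : DecidableEq J) (j₀ : J)
    (T₁ : Matrix ((A' × (C × A'' × B'')) × J) ((A' × (C × A'' × B'')) × J) ℂ)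
    (T₂ : Matrix ((B' × (C × A'' × B'')) × J) ((B' × (C × A'' × B'')) × J) ℂ)
    (d₁ : Fin M₁) (d₂ : Fin M₂),
    IsStarProjection T₁ ∧ IsStarProjection T₂ ∧
    ∀ X, code.dec X = seqDecode j₀ (posTest₁ T₁) (posTest₂ T₂) d₁ d₂
      (Matrix.reindex ((Equiv.refl C).prodCongr (e₁.prodCongr e₂))
        ((Equiv.refl C).prodCongr (e₁.prodCongr e₂)) X)

/-! The states in the rate bounds. -/

section States

variable {A B C A' A'' B' B'' : Type u}

/-- A state on `AA'A'' BB'B''` with its registers rearranged as `AB A'A''B'B''`. -/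
def rearrange (ψ : Matrix ((A × (A' × A'')) × (B × (B' × B'')))
      ((A × (A' × A'')) × (B × (B' × B''))) ℂ) :
    Matrix ((A × B) × ((A' × A'') × (B' × B''))) ((A × B) × ((A' × A'') × (B' × B''))) ℂ :=
  Matrix.reindex (Equiv.prodProdProdComm _ _ _ _) (Equiv.prodProdProdComm _ _ _ _) ψ

/-- `ω_{A'A''B'B''} = ω_{A'} ⊗ ω_{A''} ⊗ ω_{B'} ⊗ ω_{B''}`. -/
def MutuallyIndependent [Fintype A'] [Fintype A''] [Fintype B'] [Fintype B'']
    (ω : Matrix ((A' × A'') × (B' × B'')) ((A' × A'') × (B' × B'')) ℂ) : Prop :=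
  ω = (margFst (margFst ω) ⊗ₖ margSnd (margFst ω)) ⊗ₖ
    (margFst (margSnd ω) ⊗ₖ margSnd (margSnd ω))

/-- `ρ_{A'CA''B''}` from `ρ_{CA'A''B'B''}`. -/
def marg₁ [Fintype B'] (ρ : Matrix (C × ((A' × A'') × (B' × B'')))
      (C × ((A' × A'') × (B' × B''))) ℂ) :
    Matrix (A' × (C × A'' × B'')) (A' × (C × A'' × B'')) ℂ :=
  marginal (fun (a', (c, a'', b'')) (b' : B') => (c, ((a', a''), (b', b'')))) ρ

/-- `ρ_{B'CA''B''}` from `ρ_{CA'A''B'B''}`. -/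
def marg₂ [Fintype A'] (ρ : Matrix (C × ((A' × A'') × (B' × B'')))
      (C × ((A' × A'') × (B' × B''))) ℂ) :
    Matrix (B' × (C × A'' × B'')) (B' × (C × A'' × B'')) ℂ :=
  marginal (fun (b', (c, a'', b'')) (a' : A') => (c, ((a', a''), (b', b'')))) ρ

end States

end QMAC

end

/-!
The code is position-based. The first sender and the receiver share a purification of
`p ⊗ ⋯ ⊗ p ⊗ r`, where `p` and `r` are the states of `A'` and `A''`, which are independent; the
receiver holds the copies of `A'` and `A''`. The operator `posState` is the state in which the `m`-th
copy of `A'`, together with `A''` and the channel input `A`, is in the state `ψ_{AA'A''}` while the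
other copies of `A'` stay in the state `p`. The receiver's part of it does not depend on `m`, so by
steering (`exists_encoder`) a local operation of the sender, depending on `m`, produces it from the
shared pure state. The second sender does the same, and the receiver then holds `ρ` on the registers
at the positions `m₁`, `m₂`, and independent states at all other positions (`applyFst_posState`).

A test for the position `i` of the first round therefore sees `ρ_{A'CA''B''}` if `i = m₁`, and
`ρ_{A'} ⊗ ρ_{CA''B''}` otherwise (`marginal_splitFst_posReceived`). The hypothesis testing
divergence provides a test which errs with probability at most `ε₁` in the first case and `δ` in
total over the other positions (`exists_test`), and Naimark's dilation with an ancilla qubit turns it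
into a projection (`exists_naimark`).

That the measurements disturb the state is taken care of by the noncommutative union bound
(`union_bound`): the probability that all projective tests, applied in succession to the state, have
the expected results is at least `1` minus four times the sum of their individual errors. In this
event the decoding is correct (`le_seqDecode_apply`), and the individual errors add up to at most
`(ε₁ + δ) + (ε₂ + δ)`.
-/

namespace QMAC

/-! ### Square roots and supports of positive semidefinite matrices -/

/-- A positive semidefinite matrix `σ` has a Hermitian square root `S` together with a Hermitian
pseudo-inverse `T` of `S` that commutes with it. Both are functions of `σ`, with eigenvalues `√μ`
and `(√μ)⁻¹`, where `0⁻¹ = 0`; the product `S * T` is the projection on the support of `σ`. -/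
theorem exists_sqrt_pseudoInverse {X : Type*} [Fintype X] [DecidableEq X] {σ : Matrix X X ℂ}
    (hσ : σ.PosSemidef) :
    ∃ S T : Matrix X X ℂ, Sᴴ = S ∧ Tᴴ = T ∧ S * S = σ ∧ S * T = T * S ∧ S * T * S = S := by
  set U := hσ.1.eigenvectorUnitary
  have key : ∀ f g : X → ℂ, Unitary.conjStarAlgAut ℂ _ U (Matrix.diagonal f) *
      Unitary.conjStarAlgAut ℂ _ U (Matrix.diagonal g) =
      Unitary.conjStarAlgAut ℂ _ U (Matrix.diagonal fun i => f i * g i) := by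
    intro f g
    rw [← map_mul, Matrix.diagonal_mul_diagonal]
  have herm : ∀ f : X → ℝ, (Unitary.conjStarAlgAut ℂ _ U
      (Matrix.diagonal fun i => (f i : ℂ)))ᴴ =
      Unitary.conjStarAlgAut ℂ _ U (Matrix.diagonal fun i => (f i : ℂ)) := by
    intro f
    rw [← Matrix.star_eq_conjTranspose, ← map_star, Matrix.star_eq_conjTranspose,
      Matrix.diagonal_conjTranspose]
    congr 2
    ext i
    simp
  refine ⟨Unitary.conjStarAlgAut ℂ _ U (Matrix.diagonal fun i => ((√(hσ.1.eigenvalues i) : ℝ) : ℂ)),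
    Unitary.conjStarAlgAut ℂ _ U (Matrix.diagonal fun i => (((√(hσ.1.eigenvalues i))⁻¹ : ℝ) : ℂ)),
    herm _, herm _, ?_, ?_, ?_⟩
  · rw [key]
    conv_rhs => rw [hσ.1.spectral_theorem]
    congr 2
    ext i
    rw [← Complex.ofReal_mul, Real.mul_self_sqrt (hσ.eigenvalues_nonneg i)]
    rfl
  · simp only [key, mul_comm]
  · simp only [key]
    congr 2
    ext i
    rw [← Complex.ofReal_mul, ← Complex.ofReal_mul, mul_inv_mul_cancel]

/-! ### The noncommutative union bound -/

section UnionBound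

variable {X : Type*} [Fintype X]

theorem re_trace_mul_mul_conjTranspose_nonneg {ρ : Matrix X X ℂ} (hρ : ρ.PosSemidef)
    (W : Matrix X X ℂ) : 0 ≤ (W * ρ * Wᴴ).trace.re :=
  (Complex.nonneg_iff.1 (hρ.mul_mul_conjTranspose_same W).trace_nonneg).1

/-- `Tr(ρ Wᴴ)` and `Tr(W ρ)` are complex conjugates for Hermitian `ρ`. -/
theorem re_trace_mul_conjTranspose {ρ : Matrix X X ℂ} (hρ : ρ.PosSemidef) (W : Matrix X X ℂ) :
    (ρ * Wᴴ).trace.re = (W * ρ).trace.re := by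
  have h : (ρ * Wᴴ) = (W * ρ)ᴴ := by rw [Matrix.conjTranspose_mul, hρ.1]
  rw [h, Matrix.trace_conjTranspose]
  simp

variable [DecidableEq X]

/-- The potential `2 Re Tr((1 - W)ρ) - (Tr ρ - Tr(W ρ Wᴴ)) / 2`, where `W` is the product of the
projections applied so far, grows by at most `2 Tr((1 - P)ρ)` when a projection `P` is applied. -/
theorem union_bound_potential {ρ : Matrix X X ℂ} (hρ : ρ.PosSemidef) (l : List (Matrix X X ℂ))
    (hl : ∀ P ∈ l, IsStarProjection P) :
    2 * ((1 - l.prod) * ρ).trace.re - (ρ.trace.re - (l.prod * ρ * l.prodᴴ).trace.re) / 2 ≤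
      2 * (l.map fun P => ((1 - P) * ρ).trace.re).sum := by
  induction l with
  | nil => simp
  | cons P l ih =>
    specialize ih fun P hP => hl P (List.mem_cons_of_mem _ hP)
    have hP : IsStarProjection P := hl P List.mem_cons_self
    have hQ : IsStarProjection (1 - P) := hP.one_sub
    simp only [List.prod_cons, List.map_cons, List.sum_cons]
    generalize l.prod = W at *
    generalize (l.map fun P => ((1 - P) * ρ).trace.re).sum = s at *
    have hPP : P * P = P := hP.1
    have hPs : Pᴴ = P := hP.2
    -- `Tr((1-P)(W-2)ρ(W-2)ᴴ(1-P)) ≥ 0` is the inequality of the step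
    have h := re_trace_mul_mul_conjTranspose_nonneg hρ ((1 - P) * (W - 2))
    have e1 : ((1 - P) * (W - 2) * ρ * ((1 - P) * (W - 2))ᴴ).trace =
        (W * ρ * Wᴴ).trace - (P * W * ρ * (P * W)ᴴ).trace
          - 2 * ((1 - P) * W * ρ).trace - 2 * (ρ * ((1 - P) * W)ᴴ).trace
          + 4 * ((1 - P) * ρ).trace := by
      have a1 : ((1 - P) * (W - 2) * ρ * ((1 - P) * (W - 2))ᴴ).trace =
          ((1 - P) * ((W - 2) * ρ * (W - 2)ᴴ)).trace := by
        rw [Matrix.conjTranspose_mul, ← mul_assoc, Matrix.trace_mul_comm, Matrix.conjTranspose_sub,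
          hPs, Matrix.conjTranspose_one]
        simp only [← mul_assoc]
        rw [show (1 - P) * (1 - P) = 1 - P from hQ.1]
      have a2 : (P * W * ρ * (P * W)ᴴ).trace = (P * (W * ρ * Wᴴ)).trace := by
        rw [Matrix.conjTranspose_mul, ← mul_assoc, Matrix.trace_mul_comm, hPs]
        simp only [← mul_assoc]
        rw [hPP]
      have a3 : (ρ * ((1 - P) * W)ᴴ).trace = ((1 - P) * (ρ * Wᴴ)).trace := by
        rw [Matrix.conjTranspose_mul, ← mul_assoc, Matrix.trace_mul_comm, Matrix.conjTranspose_sub,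
          hPs, Matrix.conjTranspose_one]
      have h2 : ((2 : Matrix X X ℂ))ᴴ = 2 := by
        rw [← Matrix.star_eq_conjTranspose]; exact star_ofNat 2
      have a4 : (1 - P) * ((W - 2) * ρ * (W - 2)ᴴ) = (W * ρ * Wᴴ) - P * (W * ρ * Wᴴ)
          - (2 : ℂ) • ((1 - P) * W * ρ) - (2 : ℂ) • ((1 - P) * (ρ * Wᴴ))
          + (4 : ℂ) • ((1 - P) * ρ) := by
        rw [Matrix.conjTranspose_sub, h2]
        simp only [ofNat_smul_eq_nsmul]
        noncomm_ring
      rw [a1, a2, a3, a4]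
      simp [Matrix.trace_sub, Matrix.trace_add, Matrix.trace_smul]
    have e2 : ((1 - P * W) * ρ).trace = ((1 - W) * ρ).trace + ((1 - P) * W * ρ).trace := by
      rw [← Matrix.trace_add]; congr 1; noncomm_ring
    rw [e1] at h
    have e3 := re_trace_mul_conjTranspose hρ ((1 - P) * W)
    rw [e2]
    simp only [Complex.add_re, Complex.sub_re, Complex.mul_re, Complex.re_ofNat, Complex.im_ofNat,
      zero_mul, sub_zero] at h ⊢
    linarith

/-- **Gao's noncommutative union bound.** Projections, each of which accepts `ρ` up to a small
error, accept in succession up to four times the sum of the errors. -/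
theorem union_bound {ρ : Matrix X X ℂ} (hρ : ρ.PosSemidef) (l : List (Matrix X X ℂ))
    (hl : ∀ P ∈ l, IsStarProjection P) :
    ρ.trace.re - (l.prod * ρ * l.prodᴴ).trace.re ≤
      4 * (l.map fun P => ((1 - P) * ρ).trace.re).sum := by
  have h := union_bound_potential hρ l hl
  generalize l.prod = W at *
  have h1 := re_trace_mul_mul_conjTranspose_nonneg hρ (1 - W)
  have e : (1 - W) * ρ * (1 - W)ᴴ = (1 - W) * ρ - ρ * Wᴴ + W * ρ * Wᴴ := by
    rw [Matrix.conjTranspose_sub, Matrix.conjTranspose_one]; noncomm_ring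
  have e3 := re_trace_mul_conjTranspose hρ W
  have e4 : ((1 - W) * ρ).trace.re = ρ.trace.re - (W * ρ).trace.re := by
    rw [sub_mul, one_mul, Matrix.trace_sub, Complex.sub_re]
  rw [e, Matrix.trace_add, Matrix.trace_sub, Complex.add_re, Complex.sub_re] at h1
  linarith

end UnionBound

/-! ### Channels -/

/-- The linear map whose Choi matrix, with the output register first, is `J`. -/
def choiMap {X : Type u} {Y : Type v} [Fintype X] (J : Matrix (Y × X) (Y × X) ℂ) :
    Matrix X X ℂ →ₗ[ℂ] Matrix Y Y ℂ where
  toFun R := Matrix.of fun y y' => ∑ x, ∑ x', J (y, x) (y', x') * R x x'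
  map_add' R R' := by
    ext y y'
    simp [mul_add, Finset.sum_add_distrib]
  map_smul' c R := by
    ext y y'
    simp [Finset.mul_sum, mul_left_comm]

/-- The map `Z ↦ ∑ x x', Z (·, x) (·, x')` is the compression by the all-ones vector of the second
register. Applied to `J ⊗ ρ` it gives complete positivity of the map with Choi matrix `J`. -/
theorem posSemidef_sum_sum {W X : Type*} [Fintype X]
    {Z : Matrix (W × X) (W × X) ℂ} (hZ : Z.PosSemidef) [Fintype W] :
    (Matrix.of fun w w' => ∑ x, ∑ x', Z (w, x) (w', x')).PosSemidef := by
  classical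
  have h := hZ.mul_mul_conjTranspose_same
    ((1 : Matrix W W ℂ).submatrix id Prod.fst)
  convert h using 1
  ext w w'
  simp only [Matrix.of_apply, Matrix.mul_apply, Matrix.conjTranspose_apply, Fintype.sum_prod_type,
    Matrix.submatrix_apply]
  simp only [Matrix.one_apply, apply_ite star, star_one, star_zero, mul_ite,
    mul_one, mul_zero, ite_mul, one_mul, zero_mul, Finset.sum_ite_irrel, Finset.sum_const_zero,
    Finset.sum_ite_eq, Finset.mem_univ, if_true]
  rw [Finset.sum_comm]
  rfl

theorem isChannel_choiMap {X : Type u} {Y : Type v} [Fintype X] [DecidableEq X] [Fintype Y]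
    {J : Matrix (Y × X) (Y × X) ℂ} (hJ : J.PosSemidef) (h1 : margSnd J = 1) :
    IsChannel (choiMap J) where
  completelyPositive n ρ hρ := by
    have h := posSemidef_sum_sum ((hJ.kronecker hρ).submatrix
      fun p : (Y × Fin n) × X => ((p.1.1, p.2), (p.2, p.1.2)))
    exact h
  tracePreserving ρ := by
    have h : ∀ x x', ∑ y, J (y, x) (y, x') = if x = x' then 1 else 0 := by
      intro x x'
      have := congrFun (congrFun h1 x) x'
      simpa [margSnd, marginal, Matrix.one_apply] using this
    simp only [Matrix.trace, Matrix.diag, choiMap, LinearMap.coe_mk, AddHom.coe_mk, Matrix.of_apply]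
    rw [Finset.sum_comm]
    refine Finset.sum_congr rfl fun x _ => ?_
    rw [Finset.sum_comm]
    simp [← Finset.sum_mul, h]

/-- Complete positivity with an arbitrary finite reference register. -/
theorem IsChannel.posSemidef_applyFst {X : Type u} {Y : Type v} {Z : Type w} [Fintype X]
    [Fintype Y] [Fintype Z] {N : Matrix X X ℂ →ₗ[ℂ] Matrix Y Y ℂ} (hN : IsChannel N)
    {ρ : Matrix (X × Z) (X × Z) ℂ} (hρ : ρ.PosSemidef) : (applyFst N ρ).PosSemidef := by
  let e := Fintype.equivFin Z
  have h := hN.completelyPositive _ _ (hρ.submatrix (Prod.map id e.symm))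
  have h' := h.submatrix (Prod.map id e)
  convert h' using 1
  ext i j
  simp [applyFst]

theorem IsChannel.trace_applyFst {X : Type u} {Y : Type v} {Z : Type w} [Fintype X]
    [Fintype Y] [Fintype Z] {N : Matrix X X ℂ →ₗ[ℂ] Matrix Y Y ℂ} (hN : IsChannel N)
    (ρ : Matrix (X × Z) (X × Z) ℂ) : (applyFst N ρ).trace = ρ.trace := by
  simp only [Matrix.trace, Matrix.diag, applyFst, Matrix.of_apply, Fintype.sum_prod_type_right]
  refine Finset.sum_congr rfl fun z _ => ?_
  exact hN.tracePreserving (Matrix.of fun x x' => ρ (x, z) (x', z))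

/-! ### Marginals -/

theorem one_kronecker_mul_mul_apply {A K : Type*} [Fintype A] [DecidableEq A] [Fintype K]
    (S T : Matrix K K ℂ) (ω : Matrix (A × K) (A × K) ℂ) (a a' : A) (k k' : K) :
    (((1 : Matrix A A ℂ) ⊗ₖ S) * ω * ((1 : Matrix A A ℂ) ⊗ₖ T)) (a, k) (a', k') =
      ∑ x, ∑ x', S k x * ω (a, x) (a', x') * T x' k' := by
  simp only [Matrix.mul_apply, Matrix.kronecker_apply, Fintype.sum_prod_type, Matrix.one_apply,
    ite_mul, one_mul, zero_mul, mul_ite, mul_zero]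
  rw [Finset.sum_eq_single a' (by intro b _ hb; simp [hb]) (by simp), Finset.sum_comm]
  refine Finset.sum_congr rfl fun x' _ => ?_
  rw [Finset.sum_eq_single a (by intro b _ hb; simp [hb.symm]) (by simp)]
  simp [Finset.sum_mul]

theorem margSnd_conj {A K : Type*} [Fintype A] [DecidableEq A] [Fintype K]
    (S T : Matrix K K ℂ) (ω : Matrix (A × K) (A × K) ℂ) :
    margSnd (((1 : Matrix A A ℂ) ⊗ₖ S) * ω * ((1 : Matrix A A ℂ) ⊗ₖ T)) =
      S * margSnd ω * T := by
  ext k k'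
  simp only [margSnd, marginal, Matrix.of_apply, one_kronecker_mul_mul_apply]
  simp only [Matrix.mul_apply, Matrix.of_apply, Finset.mul_sum, Finset.sum_mul]
  rw [Finset.sum_comm]
  conv_rhs => rw [Finset.sum_comm]
  refine Finset.sum_congr rfl fun x _ => ?_
  rw [Finset.sum_comm]

theorem margSnd_kronecker {A K : Type*} [Fintype A] (X : Matrix A A ℂ) (Y : Matrix K K ℂ) :
    margSnd (X ⊗ₖ Y) = X.trace • Y := by
  ext k k'
  simp [margSnd, marginal, Matrix.trace, Finset.sum_mul]

theorem margFst_kronecker {A K : Type*} [Fintype K] (X : Matrix A A ℂ) (Y : Matrix K K ℂ) :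
    margFst (X ⊗ₖ Y) = Y.trace • X := by
  ext k k'
  simp [margFst, marginal, Matrix.trace, mul_comm, Finset.mul_sum]

theorem trace_margSnd {A K : Type*} [Fintype A] [Fintype K] (ω : Matrix (A × K) (A × K) ℂ) :
    (margSnd ω).trace = ω.trace := by
  simp [Matrix.trace, margSnd, marginal, Fintype.sum_prod_type_right]

theorem trace_margFst {A K : Type*} [Fintype A] [Fintype K] (ω : Matrix (A × K) (A × K) ℂ) :
    (margFst ω).trace = ω.trace := by
  simp [Matrix.trace, margFst, marginal, Fintype.sum_prod_type]

theorem posSemidef_marginal {X Y Z : Type*} [Fintype X] [Fintype Y] [Fintype Z] (f : Y → Z → X)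
    {ρ : Matrix X X ℂ} (hρ : ρ.PosSemidef) : (marginal f ρ).PosSemidef := by
  have h : marginal f ρ = ∑ z, ρ.submatrix (fun y => f y z) (fun y => f y z) := by
    ext y y'
    simp [marginal, Matrix.sum_apply]
  rw [h]
  exact Matrix.posSemidef_sum _ fun z _ => hρ.submatrix _

theorem posSemidef_single {X : Type*} [Fintype X] [DecidableEq X] (x : X) :
    (Matrix.single x x (1 : ℂ)).PosSemidef := by
  simpa using Matrix.posSemidef_conjTranspose_mul_self (Matrix.single x x (1 : ℂ))

/-- A positive semidefinite matrix that `Q` annihilates from both sides is annihilated by `Q` from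
the left; by positivity, `Q ω Qᴴ = 0` follows from its trace. -/
theorem mul_eq_zero_of_trace_conj {X : Type*} [Fintype X] {ω : Matrix X X ℂ}
    (hω : ω.PosSemidef) (Q : Matrix X X ℂ) (h : (Q * ω * Qᴴ).trace = 0) : Q * ω = 0 := by
  classical
  obtain ⟨B, -, hB, -, rfl, -⟩ := exists_sqrt_pseudoInverse hω
  have h1 : (Q * B) * (Q * B)ᴴ = Q * (B * B) * Qᴴ := by
    rw [Matrix.conjTranspose_mul, hB]; simp only [mul_assoc]
  rw [← h1, Matrix.trace_mul_conjTranspose_self_eq_zero_iff] at h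
  rw [← mul_assoc, h, zero_mul]

/-! ### Preparing an extension from a pure state -/

/-- **Steering.** If `S = √(ω_K)`, then `ω` on `A K` is obtained from the vectorization of `S`, a
purification of `ω_K`, by a channel with output `A`, whose Choi matrix is `J`. On the support of
`ω_K` this is `T ω T`, where `T` is the pseudo-inverse of `S`; on the orthogonal complement the channel
prepares a fixed basis state. -/
theorem exists_choi_of_margSnd {A K : Type*} [Fintype A] [DecidableEq A] [Nonempty A] [Fintype K]
    [DecidableEq K] {ω : Matrix (A × K) (A × K) ℂ} (hω : ω.PosSemidef) {S T : Matrix K K ℂ}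
    (hS : Sᴴ = S) (hT : Tᴴ = T) (hSS : S * S = margSnd ω) (hST : S * T = T * S)
    (hSTS : S * T * S = S) :
    ∃ J : Matrix (A × K) (A × K) ℂ, J.PosSemidef ∧ margSnd J = 1 ∧
      ((1 : Matrix A A ℂ) ⊗ₖ S) * J * ((1 : Matrix A A ℂ) ⊗ₖ S) = ω := by
  obtain ⟨a₀⟩ := ‹Nonempty A›
  have hPP : (S * T) * (S * T) = S * T := by rw [← mul_assoc, hSTS]
  have hPH : (S * T)ᴴ = S * T := by rw [Matrix.conjTranspose_mul, hS, hT, hST]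
  have hQH : (1 - S * T)ᴴ = 1 - S * T := by
    rw [Matrix.conjTranspose_sub, Matrix.conjTranspose_one, hPH]
  have hQQ : (1 - S * T) * (1 - S * T) = 1 - S * T := by
    rw [mul_sub, sub_mul _ _ (S * T), hPP]; simp
  have hQS : (1 - S * T) * S = 0 := by rw [sub_mul, hSTS, one_mul, sub_self]
  have hQ : (1 - S * T).PosSemidef := by
    rw [← hQQ]; nth_rewrite 1 [← hQH]; exact Matrix.posSemidef_conjTranspose_mul_self _
  refine ⟨((1 : Matrix A A ℂ) ⊗ₖ T) * ω * ((1 : Matrix A A ℂ) ⊗ₖ T) +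
    Matrix.single a₀ a₀ (1 : ℂ) ⊗ₖ (1 - S * T), ?_, ?_, ?_⟩
  · refine .add ?_ ((posSemidef_single a₀).kronecker hQ)
    have h := hω.mul_mul_conjTranspose_same ((1 : Matrix A A ℂ) ⊗ₖ T)
    rwa [Matrix.conjTranspose_kronecker, hT, Matrix.conjTranspose_one] at h
  · have hadd : ∀ X Y : Matrix (A × K) (A × K) ℂ, margSnd (X + Y) = margSnd X + margSnd Y := by
      intro X Y; ext; simp [margSnd, marginal, Finset.sum_add_distrib]
    rw [hadd, margSnd_conj, margSnd_kronecker, ← hSS, Matrix.trace_single_eq_same, one_smul]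
    have : T * (S * S) * T = S * T := by
      calc T * (S * S) * T = (T * S) * (S * T) := by simp only [mul_assoc]
        _ = S * T := by rw [← hST, hPP]
    rw [this, add_sub_cancel]
  · have hker : ((1 : Matrix A A ℂ) ⊗ₖ (1 - S * T)) * ω = 0 := by
      refine mul_eq_zero_of_trace_conj hω _ ?_
      rw [Matrix.conjTranspose_kronecker, hQH, Matrix.conjTranspose_one, ← trace_margSnd,
        margSnd_conj, ← hSS, ← mul_assoc, hQS]
      simp
    have hker' : ω * ((1 : Matrix A A ℂ) ⊗ₖ (1 - S * T)) = 0 := by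
      have := congrArg Matrix.conjTranspose hker
      rwa [Matrix.conjTranspose_mul, hω.1, Matrix.conjTranspose_kronecker, hQH,
        Matrix.conjTranspose_one, Matrix.conjTranspose_zero] at this
    have hsplit : (1 : Matrix A A ℂ) ⊗ₖ (S * T) = 1 - (1 : Matrix A A ℂ) ⊗ₖ (1 - S * T) := by
      rw [eq_sub_iff_add_eq, ← Matrix.kronecker_add, add_sub_cancel, Matrix.one_kronecker_one]
    rw [mul_add, add_mul]
    have h1 : ((1 : Matrix A A ℂ) ⊗ₖ S) * (((1 : Matrix A A ℂ) ⊗ₖ T) * ω *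
        ((1 : Matrix A A ℂ) ⊗ₖ T)) * ((1 : Matrix A A ℂ) ⊗ₖ S) =
        ((1 : Matrix A A ℂ) ⊗ₖ (S * T)) * ω * ((1 : Matrix A A ℂ) ⊗ₖ (S * T)) := by
      have e1 : ((1 : Matrix A A ℂ) ⊗ₖ S) * ((1 : Matrix A A ℂ) ⊗ₖ T) =
          (1 : Matrix A A ℂ) ⊗ₖ (S * T) := by rw [← Matrix.mul_kronecker_mul, mul_one]
      have e2 : ((1 : Matrix A A ℂ) ⊗ₖ T) * ((1 : Matrix A A ℂ) ⊗ₖ S) =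
          (1 : Matrix A A ℂ) ⊗ₖ (S * T) := by rw [← Matrix.mul_kronecker_mul, mul_one, hST]
      rw [← mul_assoc, ← mul_assoc, e1, mul_assoc, e2]
    have h2 : ((1 : Matrix A A ℂ) ⊗ₖ S) * (Matrix.single a₀ a₀ (1 : ℂ) ⊗ₖ (1 - S * T)) *
        ((1 : Matrix A A ℂ) ⊗ₖ S) = 0 := by
      rw [← Matrix.mul_kronecker_mul, ← Matrix.mul_kronecker_mul, mul_assoc S, hQS]
      simp
    rw [h1, h2, hsplit, sub_mul, one_mul, hker, sub_zero, mul_sub, hker', mul_one, sub_zero,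
      add_zero]

/-- A sender who shares a suitable pure state with the receiver can, depending on a message, prepare
any extension to `A` of the receiver's reduced state `σ`. -/
theorem exists_encoder {A K : Type u} [Fintype A] [Nonempty A] [Fintype K] {M : ℕ}
    {σ : Matrix K K ℂ} (hσ : IsState σ) {ω : Fin M → Matrix (A × K) (A × K) ℂ}
    (hω : ∀ m, (ω m).PosSemidef) (hωσ : ∀ m, margSnd (ω m) = σ) :
    ∃ (θ : K × K → ℂ) (enc : Matrix (Fin M × K) (Fin M × K) ℂ →ₗ[ℂ] Matrix A A ℂ),
      ∑ i, ‖θ i‖ ^ 2 = 1 ∧ IsChannel enc ∧ ∀ m, encoded enc θ m = ω m := by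
  classical
  obtain ⟨S, T, hS, hT, hSS, hST, hSTS⟩ := exists_sqrt_pseudoInverse hσ.1
  choose J hJ hJ1 hJω using fun m =>
    exists_choi_of_margSnd (hω m) hS hT (hSS.trans (hωσ m).symm) hST hSTS
  set JJ : Matrix (A × (Fin M × K)) (A × (Fin M × K)) ℂ :=
    ∑ m, (J m ⊗ₖ Matrix.single m m (1 : ℂ)).submatrix
      (fun x => ((x.1, x.2.2), x.2.1)) (fun x => ((x.1, x.2.2), x.2.1)) with hJJ
  have hJJ_apply : ∀ a m e a' m' e', JJ (a, (m, e)) (a', (m', e')) =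
      if m = m' then J m (a, e) (a', e') else 0 := by
    intro a m e a' m' e'
    simp only [hJJ, Matrix.sum_apply, Matrix.submatrix_apply, Matrix.kronecker_apply,
      Matrix.single_apply, mul_ite, mul_one, mul_zero]
    by_cases h : m = m'
    · subst h; simp
    · rw [if_neg h]
      refine Finset.sum_eq_zero fun i _ => if_neg ?_
      rintro ⟨rfl, rfl⟩; exact h rfl
  refine ⟨fun p => S p.2 p.1, choiMap JJ, ?_, isChannel_choiMap ?_ ?_, ?_⟩
  · have h : ((∑ p : K × K, ‖S p.2 p.1‖ ^ 2 : ℝ) : ℂ) = 1 := by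
      rw [← hσ.2, ← hSS]
      nth_rewrite 3 [← hS]
      push_cast
      simp only [Matrix.trace, Matrix.diag, Matrix.mul_apply, Matrix.conjTranspose_apply,
        Fintype.sum_prod_type_right]
      refine Finset.sum_congr rfl fun c _ => Finset.sum_congr rfl fun e _ => ?_
      exact (RCLike.mul_conj _).symm
    exact_mod_cast h
  · exact Matrix.posSemidef_sum _ fun m _ => ((hJ m).kronecker (posSemidef_single m)).submatrix _
  · ext ⟨m, e⟩ ⟨m', e'⟩
    simp only [margSnd, marginal, Matrix.of_apply, hJJ_apply]
    by_cases h : m = m'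
    · subst h
      have := congrFun (congrFun (hJ1 m) e) e'
      simpa [margSnd, marginal, Matrix.one_apply] using this
    · simp [h]
  · intro m
    ext ⟨a, c⟩ ⟨a', c'⟩
    rw [← hJω m, one_kronecker_mul_mul_apply]
    simp only [encoded, applyFst, choiMap, LinearMap.coe_mk, AddHom.coe_mk, Matrix.of_apply,
      Matrix.reindex_apply, Equiv.symm_symm, Matrix.submatrix_apply, Equiv.prodAssoc_apply,
      Matrix.kronecker_apply, Fintype.sum_prod_type, hJJ_apply, Matrix.vecMulVec_apply,
      Matrix.single_apply, Pi.star_apply]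
    rw [Finset.sum_eq_single m (by intro b _ hb; simp [hb.symm]) (by simp)]
    refine Finset.sum_congr rfl fun e _ => ?_
    rw [Finset.sum_eq_single m (by intro b _ hb; simp [hb.symm]) (by simp)]
    refine Finset.sum_congr rfl fun e' _ => ?_
    have hSe : star (S c' e') = S e' c' := by
      rw [← Matrix.conjTranspose_apply, hS]
    simp only [hSe, and_self, if_true, one_mul]
    ring

/-! ### Naimark dilation of a test -/

/-- A test `0 ≤ Λ ≤ 1` is the compression, to an ancilla qubit in its first basis state, of a
projection `V Vᴴ`, where `V` is the isometry with the blocks `√Λ` and `√(1 - Λ)`. -/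
theorem exists_naimark {Y : Type u} [Fintype Y] [DecidableEq Y] {Λ : Matrix Y Y ℂ}
    (h0 : Λ.PosSemidef) (h1 : (1 - Λ).PosSemidef) :
    ∃ T : Matrix (Y × Option PUnit.{u + 1}) (Y × Option PUnit.{u + 1}) ℂ, IsStarProjection T ∧
      T.submatrix (fun y => (y, none)) (fun y => (y, none)) = Λ := by
  obtain ⟨S, -, hS, -, hSS, -⟩ := exists_sqrt_pseudoInverse h0
  obtain ⟨S', -, hS', -, hSS', -⟩ := exists_sqrt_pseudoInverse h1
  set V : Matrix (Y × Option PUnit.{u + 1}) Y ℂ :=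
    Matrix.of fun p z => if p.2 = none then S p.1 z else S' p.1 z with hV
  have hVV : Vᴴ * V = 1 := by
    have : Vᴴ * V = S * S + S' * S' := by
      nth_rewrite 1 [← hS, ← hS']
      ext y y'
      simp [hV, Matrix.mul_apply, Fintype.sum_prod_type_right]
    rw [this, hSS, hSS', add_sub_cancel]
  refine ⟨V * Vᴴ, ⟨?_, ?_⟩, ?_⟩
  · change V * Vᴴ * (V * Vᴴ) = V * Vᴴ
    rw [Matrix.mul_assoc, ← Matrix.mul_assoc Vᴴ, hVV, Matrix.one_mul]
  · change (V * Vᴴ)ᴴ = V * Vᴴ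
    rw [Matrix.conjTranspose_mul, Matrix.conjTranspose_conjTranspose]
  · rw [← hSS]
    nth_rewrite 2 [← hS]
    ext y y'
    simp [hV, Matrix.mul_apply]

/-! ### Sequential measurements -/

section Decoder

theorem seqOp_cons {X : Type*} [Fintype X] [DecidableEq X] {M : ℕ}
    (P : Fin (M + 1) → Matrix X X ℂ) (b : Bool) (s : Fin M → Bool) :
    seqOp P (Fin.cons b s : Fin (M + 1) → Bool) =
      seqOp (fun i => P i.succ) s * (if b then P 0 else 1 - P 0) := by
  simp [seqOp, List.ofFn_succ]

/-- The Kraus operators of a sequence of projective measurements form a complete family. -/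
theorem sum_seqOp {X : Type*} [Fintype X] [DecidableEq X] {M : ℕ} (P : Fin M → Matrix X X ℂ)
    (hP : ∀ i, IsStarProjection (P i)) : ∑ s, (seqOp P s)ᴴ * seqOp P s = 1 := by
  induction M with
  | zero => simp [seqOp]
  | succ M ih =>
    have h2 : ∀ T : Matrix X X ℂ, IsStarProjection T → Tᴴ * T = T := fun T hT => by
      rw [← Matrix.star_eq_conjTranspose, hT.2, hT.1]
    rw [← (Fin.consEquiv fun _ => Bool).sum_comp, Fintype.sum_prod_type]
    simp only [Fin.consEquiv, Equiv.coe_fn_mk, seqOp_cons, Matrix.conjTranspose_mul, mul_assoc]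
    have h3 : ∀ T : Matrix X X ℂ, ∑ s : Fin M → Bool, Tᴴ * ((seqOp (fun i => P i.succ) s)ᴴ *
        (seqOp (fun i => P i.succ) s * T)) = Tᴴ * T := fun T => by
      simp only [← mul_assoc]
      rw [← Finset.sum_mul]
      simp only [mul_assoc]
      rw [← Finset.mul_sum, ih _ fun i => hP _, mul_one]
    simp only [h3, Fintype.sum_bool, if_true, Bool.false_eq_true, if_false]
    rw [h2 _ (hP 0), h2 _ (hP 0).one_sub, add_sub_cancel]

theorem trace_mul_kronecker_single {K J : Type*} [Fintype K] [Fintype J] [DecidableEq J]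
    (j₀ : J) (G : Matrix (K × J) (K × J) ℂ) (X : Matrix K K ℂ) :
    (G * (X ⊗ₖ Matrix.single j₀ j₀ (1 : ℂ))).trace =
      (G.submatrix (fun k => (k, j₀)) (fun k => (k, j₀)) * X).trace := by
  simp only [Matrix.trace, Matrix.diag, Matrix.mul_apply, Fintype.sum_prod_type,
    Matrix.kronecker_apply, Matrix.single_apply, Matrix.submatrix_apply, mul_ite, mul_one, mul_zero]
  refine Finset.sum_congr rfl fun k _ => ?_
  rw [Finset.sum_comm]
  refine (Finset.sum_congr rfl fun k' _ => ?_)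
  rw [Finset.sum_eq_single j₀ (by intro b _ hb; simp [hb.symm]) (by simp)]
  simp

variable {K : Type u} {J : Type v} [Fintype K] [DecidableEq K] [Fintype J] [DecidableEq J]
  {M₁ M₂ : ℕ}

/-- The sequential decoder is a channel. -/
theorem exists_isChannel_seqDecode (j₀ : J) {P : Fin M₁ → Matrix (K × J) (K × J) ℂ}
    {Q : Fin M₂ → Matrix (K × J) (K × J) ℂ} (hP : ∀ i, IsStarProjection (P i))
    (hQ : ∀ i, IsStarProjection (Q i)) (d₁ : Fin M₁) (d₂ : Fin M₂) :
    ∃ dec : Matrix K K ℂ →ₗ[ℂ] Matrix (Fin M₁ × Fin M₂) (Fin M₁ × Fin M₂) ℂ,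
      IsChannel dec ∧ ∀ X, dec X = seqDecode j₀ P Q d₁ d₂ X := by
  set W : (Fin M₁ → Bool) × (Fin M₂ → Bool) → Matrix (K × J) (K × J) ℂ :=
    fun s => seqOp Q s.2 * seqOp P s.1 with hW
  set out : (Fin M₁ → Bool) × (Fin M₂ → Bool) → Fin M₁ × Fin M₂ :=
    fun s => (firstYes d₁ s.1, firstYes d₂ s.2) with hout
  set G : (Fin M₁ → Bool) × (Fin M₂ → Bool) → Matrix K K ℂ :=
    fun s => ((W s)ᴴ * W s).submatrix (fun k => (k, j₀)) (fun k => (k, j₀)) with hG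
  have hWW : ∑ s, (W s)ᴴ * W s = 1 := by
    simp only [hW, Fintype.sum_prod_type, Matrix.conjTranspose_mul]
    have h : ∀ s : Fin M₁ → Bool, ∑ t : Fin M₂ → Bool, (seqOp P s)ᴴ * (seqOp Q t)ᴴ *
        (seqOp Q t * seqOp P s) = (seqOp P s)ᴴ * seqOp P s := fun s => by
      simp only [← mul_assoc]
      rw [← Finset.sum_mul]
      simp only [mul_assoc]
      rw [← Finset.mul_sum, sum_seqOp Q hQ, mul_one]
    simp only [h, sum_seqOp P hP]
  have hG1 : ∑ s, G s = 1 := by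
    ext k k'
    have := congrFun (congrFun hWW (k, j₀)) (k', j₀)
    simpa [hG, Matrix.sum_apply, Matrix.one_apply] using this
  refine ⟨choiMap (∑ s, Matrix.single (out s) (out s) (1 : ℂ) ⊗ₖ (G s)ᵀ),
    isChannel_choiMap ?_ ?_, fun X => ?_⟩
  · exact Matrix.posSemidef_sum _ fun s _ => (posSemidef_single _).kronecker
      ((Matrix.posSemidef_conjTranspose_mul_self (W s)).submatrix _).transpose
  · have h : ∀ s, margSnd (Matrix.single (out s) (out s) (1 : ℂ) ⊗ₖ (G s)ᵀ) = (G s)ᵀ := fun s => by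
      rw [margSnd_kronecker, Matrix.trace_single_eq_same, one_smul]
    have hsum : margSnd (∑ s, Matrix.single (out s) (out s) (1 : ℂ) ⊗ₖ (G s)ᵀ) =
        ∑ s, margSnd (Matrix.single (out s) (out s) (1 : ℂ) ⊗ₖ (G s)ᵀ) := by
      ext k k'
      simp only [margSnd, marginal, Matrix.of_apply, Matrix.sum_apply]
      exact Finset.sum_comm
    rw [hsum]
    simp only [h]
    rw [← Matrix.transpose_sum, hG1, Matrix.transpose_one]
  · have htr : ∀ s, (W s * (X ⊗ₖ Matrix.single j₀ j₀ (1 : ℂ)) * (W s)ᴴ).trace = (G s * X).trace :=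
      fun s => by
        rw [Matrix.trace_mul_comm, ← mul_assoc, trace_mul_kronecker_single]
    ext m m'
    simp only [seqDecode, choiMap, LinearMap.coe_mk, AddHom.coe_mk, Matrix.of_apply,
      Matrix.diagonal_apply, Matrix.sum_apply, Matrix.kronecker_apply, Matrix.single_apply,
      Matrix.transpose_apply, Finset.sum_mul]
    have hX : ∀ s, ∑ x, ∑ x', G s x' x * X x x' = (G s * X).trace := fun s => by
      rw [Finset.sum_comm]; rfl
    have hL : ∑ x, ∑ x', ∑ s, (if out s = m ∧ out s = m' then (1 : ℂ) else 0) * G s x' x * X x x' =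
        ∑ s, if out s = m ∧ out s = m' then (G s * X).trace else 0 := by
      simp_rw [Finset.sum_comm (t := (Finset.univ : Finset ((Fin M₁ → Bool) × (Fin M₂ → Bool)))),
        ← hX, mul_assoc, ← Finset.mul_sum, ite_mul, one_mul, zero_mul]
    rw [hL, Finset.sum_filter]
    by_cases h : m = m'
    · subst h
      simp only [and_self, if_true]
      exact Finset.sum_congr rfl fun s _ => by rw [← htr]
    · rw [if_neg h]
      exact Finset.sum_eq_zero fun s _ => if_neg fun ⟨h1, h2⟩ => h (h1.symm.trans h2)

theorem firstYes_eq {M : ℕ} (d m : Fin M) : firstYes d (fun i => decide (i = m)) = m := by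
  have h : (List.finRange M).find? (fun i => decide (i = m)) = some m := by
    rcases h : (List.finRange M).find? (fun i => decide (i = m)) with _ | i
    · rw [List.find?_eq_none] at h
      simpa using h m (List.mem_finRange m)
    · have := List.find?_some h
      simpa using this
  simp [firstYes, h]

/-- The probability of a correct output is at least that of every test giving the expected result,
to which the union bound applies. -/
theorem le_seqDecode_apply (j₀ : J) {P : Fin M₁ → Matrix (K × J) (K × J) ℂ}
    {Q : Fin M₂ → Matrix (K × J) (K × J) ℂ} (hP : ∀ i, IsStarProjection (P i))
    (hQ : ∀ i, IsStarProjection (Q i)) (d₁ : Fin M₁) (d₂ : Fin M₂) {X : Matrix K K ℂ}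
    (hX : X.PosSemidef) (m : Fin M₁ × Fin M₂) :
    X.trace.re - 4 *
      (∑ i, (if i = m.1 then X.trace.re - (P i * (X ⊗ₖ Matrix.single j₀ j₀ (1 : ℂ))).trace.re
          else (P i * (X ⊗ₖ Matrix.single j₀ j₀ (1 : ℂ))).trace.re) +
        ∑ i, if i = m.2 then X.trace.re - (Q i * (X ⊗ₖ Matrix.single j₀ j₀ (1 : ℂ))).trace.re
          else (Q i * (X ⊗ₖ Matrix.single j₀ j₀ (1 : ℂ))).trace.re) ≤
      (seqDecode j₀ P Q d₁ d₂ X m m).re := by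
  set Y := X ⊗ₖ Matrix.single j₀ j₀ (1 : ℂ) with hYdef
  have hY : Y.PosSemidef := hX.kronecker (posSemidef_single j₀)
  have hYtr : Y.trace = X.trace := by
    rw [hYdef, Matrix.trace_kronecker, Matrix.trace_single_eq_same, mul_one]
  set s : (Fin M₁ → Bool) × (Fin M₂ → Bool) :=
    (fun i => decide (i = m.1), fun i => decide (i = m.2)) with hs
  set l : List (Matrix (K × J) (K × J) ℂ) :=
    (List.ofFn fun i => if s.2 i then Q i else 1 - Q i).reverse ++
      (List.ofFn fun i => if s.1 i then P i else 1 - P i).reverse with hl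
  have hproj : ∀ T ∈ l, IsStarProjection T := by
    intro T hT
    simp only [hl, List.mem_append, List.mem_reverse, List.mem_ofFn'] at hT
    rcases hT with ⟨i, rfl⟩ | ⟨i, rfl⟩
    · by_cases h : s.2 i
      · simpa [h] using hQ i
      · simpa [h] using (hQ i).one_sub
    · by_cases h : s.1 i
      · simpa [h] using hP i
      · simpa [h] using (hP i).one_sub
  have hb := union_bound hY l hproj
  have hprod : l.prod = seqOp Q s.2 * seqOp P s.1 := by
    rw [hl, List.prod_append]; rfl
  have hsum : (l.map fun T => ((1 - T) * Y).trace.re).sum =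
      ∑ i, (if i = m.1 then X.trace.re - (P i * Y).trace.re else (P i * Y).trace.re) +
        ∑ i, if i = m.2 then X.trace.re - (Q i * Y).trace.re else (Q i * Y).trace.re := by
    rw [hl, List.map_append, List.sum_append, List.map_reverse, List.map_reverse, List.sum_reverse,
      List.sum_reverse, List.map_ofFn, List.map_ofFn, List.sum_ofFn, List.sum_ofFn, add_comm]
    congr 1
    · refine Finset.sum_congr rfl fun i _ => ?_
      by_cases h : i = m.1 <;> simp [hs, h, sub_mul, hYtr]
    · refine Finset.sum_congr rfl fun i _ => ?_
      by_cases h : i = m.2 <;> simp [hs, h, sub_mul, hYtr]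
  rw [hprod, hsum, hYtr] at hb
  have hle : ((seqOp Q s.2 * seqOp P s.1) * Y * (seqOp Q s.2 * seqOp P s.1)ᴴ).trace.re ≤
      (seqDecode j₀ P Q d₁ d₂ X m m).re := by
    simp only [seqDecode, Matrix.diagonal_apply_eq, Complex.re_sum]
    refine Finset.single_le_sum (f := fun s : (Fin M₁ → Bool) × (Fin M₂ → Bool) =>
      ((seqOp Q s.2 * seqOp P s.1) * Y * (seqOp Q s.2 * seqOp P s.1)ᴴ).trace.re)
      (fun s _ => re_trace_mul_mul_conjTranspose_nonneg hY _) ?_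
    simp [hs, firstYes_eq]
  linarith

theorem seqDecode_apply_nonneg (j₀ : J) (P : Fin M₁ → Matrix (K × J) (K × J) ℂ)
    (Q : Fin M₂ → Matrix (K × J) (K × J) ℂ) (d₁ : Fin M₁) (d₂ : Fin M₂) {X : Matrix K K ℂ}
    (hX : X.PosSemidef) (m : Fin M₁ × Fin M₂) :
    0 ≤ (seqDecode j₀ P Q d₁ d₂ X m m).re := by
  simp only [seqDecode, Matrix.diagonal_apply_eq, Complex.re_sum]
  exact Finset.sum_nonneg fun s _ => re_trace_mul_mul_conjTranspose_nonneg
    (hX.kronecker (posSemidef_single j₀)) _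

end Decoder

/-! ### Tests on one copy of a register -/

section Tests

variable {K Y R J : Type*}

/-- The operator `T` on `Y J`, extended by the identity on `R` to an operator on `K J`, where `e`
splits the register `K` into `Y` and `R`. -/
noncomputable def onFactor [DecidableEq R] (e : K ≃ Y × R) (T : Matrix (Y × J) (Y × J) ℂ) :
    Matrix (K × J) (K × J) ℂ :=
  (T ⊗ₖ (1 : Matrix R R ℂ)).submatrix (fun x => (((e x.1).1, x.2), (e x.1).2))
    (fun x => (((e x.1).1, x.2), (e x.1).2))

theorem isStarProjection_onFactor [Fintype K] [Fintype Y] [Fintype R] [Fintype J] [DecidableEq R]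
    (e : K ≃ Y × R) {T : Matrix (Y × J) (Y × J) ℂ} (hT : IsStarProjection T) :
    IsStarProjection (onFactor e T) := by
  let f : K × J ≃ (Y × J) × R :=
    { toFun := fun x => (((e x.1).1, x.2), (e x.1).2)
      invFun := fun z => (e.symm (z.1.1, z.2), z.1.2)
      left_inv := fun x => by simp
      right_inv := fun z => by simp }
  have hf : onFactor e T = (T ⊗ₖ (1 : Matrix R R ℂ)).submatrix f f := rfl
  have h1 : T * T = T := hT.1
  have h2 : Tᴴ = T := hT.2
  rw [hf]
  constructor
  · change _ * _ = _
    rw [Matrix.submatrix_mul_equiv, ← Matrix.mul_kronecker_mul, h1, mul_one]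
  · change _ᴴ = _
    rw [Matrix.conjTranspose_submatrix, Matrix.conjTranspose_kronecker, h2,
      Matrix.conjTranspose_one]

/-- With the ancilla in the state `j₀`, the projection `T` has the acceptance probability of its
compression to `j₀`, evaluated on the marginal on `Y`. -/
theorem trace_onFactor_mul [Fintype K] [Fintype Y] [Fintype R] [Fintype J] [DecidableEq R]
    [DecidableEq J] (e : K ≃ Y × R) (T : Matrix (Y × J) (Y × J) ℂ) (j₀ : J) (X : Matrix K K ℂ) :
    (onFactor e T * (X ⊗ₖ Matrix.single j₀ j₀ (1 : ℂ))).trace =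
      (T.submatrix (fun y => (y, j₀)) (fun y => (y, j₀)) *
        marginal (fun y r => e.symm (y, r)) X).trace := by
  rw [trace_mul_kronecker_single]
  simp only [Matrix.trace, Matrix.diag, Matrix.mul_apply, Matrix.submatrix_apply, onFactor,
    marginal, Matrix.of_apply]
  rw [← e.symm.sum_comp]
  simp_rw [← e.symm.sum_comp (M := ℂ)]
  simp only [Equiv.apply_symm_apply, Fintype.sum_prod_type, Matrix.kronecker_apply,
    Matrix.one_apply, mul_ite, mul_one, mul_zero, ite_mul, zero_mul, Finset.sum_ite_eq,
    Finset.mem_univ, if_true, Finset.mul_sum]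
  refine Finset.sum_congr rfl fun y _ => ?_
  rw [Finset.sum_comm]

end Tests

/-! ### The states of position-based coding -/

section Position

/-- The operator on a sender's output `A` and the receiver's registers `A'₁ … A'_M A''` that is `α` on
`A A'_m A''`, in tensor product with `p` on every other copy of `A'`. The factor at the position `m`
of the product over all positions is replaced by `1`. -/
noncomputable def posState {A A' A'' : Type*} {M : ℕ}
    (α : Matrix (A × (A' × A'')) (A × (A' × A'')) ℂ) (p : Matrix A' A' ℂ) (m : Fin M) :
    Matrix (A × ((Fin M → A') × A'')) (A × ((Fin M → A') × A'')) ℂ :=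
  Matrix.of fun x y => α (x.1, (x.2.1 m, x.2.2)) (y.1, (y.2.1 m, y.2.2)) *
    ∏ j, if j = m then 1 else p (x.2.1 j) (y.2.1 j)

/-- `p ⊗ ⋯ ⊗ p ⊗ r`, with `M` factors `p`. -/
noncomputable def powState {A' A'' : Type*} (M : ℕ) (p : Matrix A' A' ℂ) (r : Matrix A'' A'' ℂ) :
    Matrix ((Fin M → A') × A'') ((Fin M → A') × A'') ℂ :=
  Matrix.of fun x y => (∏ j, p (x.1 j) (y.1 j)) * r x.2 y.2

theorem posSemidef_prod_hadamard {X ι : Type*} [Fintype X] (s : Finset ι)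
    {F : ι → Matrix X X ℂ} (hF : ∀ i, (F i).PosSemidef) :
    (Matrix.of fun x y => ∏ i ∈ s, F i x y).PosSemidef := by
  classical
  induction s using Finset.induction_on with
  | empty =>
    convert Matrix.posSemidef_vecMulVec_self_star (fun _ : X => (1 : ℂ)) using 1
    ext x y
    simp [Matrix.vecMulVec_apply]
  | insert i s hi ih =>
    have e : (Matrix.of fun x y => ∏ i ∈ insert i s, F i x y) =
        F i ⊙ Matrix.of fun x y => ∏ i ∈ s, F i x y := by
      ext x y
      simp [Finset.prod_insert hi]
    rw [e]
    exact (hF i).hadamard ih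

theorem posSemidef_posState {A A' A'' : Type*} [Fintype A] [Fintype A'] [Fintype A''] {M : ℕ}
    {α : Matrix (A × (A' × A'')) (A × (A' × A'')) ℂ} {p : Matrix A' A' ℂ} (hα : α.PosSemidef)
    (hp : p.PosSemidef) (m : Fin M) : (posState α p m).PosSemidef := by
  have h1 : (Matrix.of fun _ _ : A × ((Fin M → A') × A'') => (1 : ℂ)).PosSemidef := by
    simpa using posSemidef_prod_hadamard (∅ : Finset Unit)
      (F := fun _ => (0 : Matrix (A × ((Fin M → A') × A'')) (A × ((Fin M → A') × A'')) ℂ))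
      (fun _ => .zero)
  have h2 := posSemidef_prod_hadamard (Finset.univ : Finset (Fin M))
    (F := fun j => if j = m then Matrix.of fun _ _ : A × ((Fin M → A') × A'') => (1 : ℂ) else
      p.submatrix (fun x => x.2.1 j) (fun x => x.2.1 j))
    (fun j => by split_ifs; exacts [h1, hp.submatrix _])
  have e : posState α p m = (α.submatrix (fun x : A × ((Fin M → A') × A'') =>
      (x.1, (x.2.1 m, x.2.2))) fun x => (x.1, (x.2.1 m, x.2.2))) ⊙
      Matrix.of fun x y => ∏ j, (if j = m then Matrix.of fun _ _ => (1 : ℂ) else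
        p.submatrix (fun x => x.2.1 j) (fun x => x.2.1 j)) x y := by
    ext x y
    simp only [posState, Matrix.of_apply, Matrix.hadamard_apply, Matrix.submatrix_apply]
    congr 1
    refine Finset.prod_congr rfl fun j _ => ?_
    split_ifs <;> rfl
  rw [e]
  exact (hα.submatrix _).hadamard h2

/-- A factor `h` in front takes the position `m` that the product leaves free. -/
theorem mul_prod_ite {ι : Type*} [Fintype ι] [DecidableEq ι] (m : ι) (h : ℂ) (w : ι → ℂ) :
    h * ∏ j, (if j = m then 1 else w j) = ∏ j, if j = m then h else w j := by
  rw [← Finset.mul_prod_erase _ _ (Finset.mem_univ m),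
    ← Finset.mul_prod_erase _ (fun j => if j = m then h else w j) (Finset.mem_univ m)]
  simp only [if_true, one_mul]
  congr 1
  refine Finset.prod_congr rfl fun j hj => ?_
  rw [if_neg (Finset.ne_of_mem_erase hj), if_neg (Finset.ne_of_mem_erase hj)]

theorem margSnd_posState {A A' A'' : Type*} [Fintype A] {M : ℕ}
    {α : Matrix (A × (A' × A'')) (A × (A' × A'')) ℂ} {p : Matrix A' A' ℂ} {r : Matrix A'' A'' ℂ}
    (hα : margSnd α = p ⊗ₖ r) (m : Fin M) : margSnd (posState α p m) = powState M p r := by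
  ext ⟨f, x⟩ ⟨g, y⟩
  have h := congrFun (congrFun hα (f m, x)) (g m, y)
  simp only [margSnd, marginal, Matrix.of_apply, Matrix.kronecker_apply] at h
  simp only [margSnd, marginal, Matrix.of_apply, posState, powState]
  rw [← Finset.sum_mul, h, mul_right_comm, mul_prod_ite]
  congr 1
  refine Finset.prod_congr rfl fun j _ => ?_
  split_ifs with hj
  · rw [hj]
  · rfl

/-- Summing out all copies of a register but the `i`-th, of a product whose factor at the position
`m` is `h` and whose other factors are `p`. -/
theorem sum_other_copies {A' : Type*} [Fintype A'] {M : ℕ} {p : Matrix A' A' ℂ}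
    (hp : p.trace = 1) (i m : Fin M) (h : A' → A' → ℂ) (a a' : A') :
    ∑ r : {j // j ≠ i} → A', h ((Equiv.funSplitAt i A').symm (a, r) m)
        ((Equiv.funSplitAt i A').symm (a', r) m) *
      ∏ j, (if j = m then 1 else p ((Equiv.funSplitAt i A').symm (a, r) j)
        ((Equiv.funSplitAt i A').symm (a', r) j)) =
      if i = m then h a a' else p a a' * ∑ b, h b b := by
  classical
  have hp' : ∑ b, p b b = 1 := hp
  set w : Fin M → A' → A' → ℂ := fun j b b' => if j = m then h b b' else p b b' with hw
  have hprod : ∀ f g : Fin M → A', h (f m) (g m) * ∏ j, (if j = m then 1 else p (f j) (g j)) =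
      ∏ j, w j (f j) (g j) := fun f g => by
    rw [mul_prod_ite]
    refine Finset.prod_congr rfl fun j _ => ?_
    by_cases hj : j = m
    · simp [hw, hj]
    · simp [hw, hj]
  have hsplit : ∀ F : Fin M → ℂ, ∏ j, F j = F i * ∏ j : {j // j ≠ i}, F j := fun F => by
    rw [← Finset.mul_prod_erase _ _ (Finset.mem_univ i)]
    exact congrArg _ (Finset.prod_subtype _ (fun j => by simp) F)
  have hr : ∀ r : {j // j ≠ i} → A', ∏ j, w j ((Equiv.funSplitAt i A').symm (a, r) j)
      ((Equiv.funSplitAt i A').symm (a', r) j) =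
      w i a a' * ∏ j : {j // j ≠ i}, w j (r j) (r j) := fun r => by
    rw [hsplit]
    congr 1
    · simp
    · refine Finset.prod_congr rfl fun j _ => ?_
      simp [j.2]
  simp only [hprod, hr]
  rw [← Finset.mul_sum, ← Fintype.piFinset_univ, ← Finset.prod_univ_sum
    (t := fun _ : {j // j ≠ i} => (Finset.univ : Finset A')) (f := fun j b => w j b b)]
  by_cases him : i = m
  · rw [if_pos him, Finset.prod_eq_one, mul_one]
    · simp [hw, him]
    · intro j _
      have : j.1 ≠ m := him ▸ j.2
      simp [hw, this, hp']
  · rw [if_neg him, Finset.prod_eq_single ⟨m, Ne.symm him⟩]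
    · simp [hw, him]
    · intro j _ hj
      have : j.1 ≠ m := fun h => hj (Subtype.ext h)
      simp [hw, this, hp']
    · simp

theorem sum_copies {A' : Type*} [Fintype A'] {M : ℕ} {p : Matrix A' A' ℂ}
    (hp : p.trace = 1) (m : Fin M) (h : A' → ℂ) :
    ∑ f : Fin M → A', h (f m) * ∏ j, (if j = m then 1 else p (f j) (f j)) = ∑ b, h b := by
  classical
  rw [← (Equiv.funSplitAt m A').symm.sum_comp, Fintype.sum_prod_type]
  refine Finset.sum_congr rfl fun a _ => ?_
  have := sum_other_copies hp m m (fun b _ => h b) a a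
  rwa [if_pos rfl] at this

theorem isState_powState {A' A'' : Type*} [Fintype A'] [Fintype A''] (M : ℕ) {p : Matrix A' A' ℂ}
    {r : Matrix A'' A'' ℂ} (hp : IsState p) (hr : IsState r) : IsState (powState M p r) := by
  constructor
  · exact (posSemidef_prod_hadamard (Finset.univ : Finset (Fin M))
      (F := fun j => p.submatrix (fun x : (Fin M → A') × A'' => x.1 j) (fun x => x.1 j))
      (fun j => hp.1.submatrix _)).hadamard (hr.1.submatrix Prod.snd)
  · have hp' : ∑ b, p b b = 1 := hp.2
    have hr' : ∑ b, r b b = 1 := hr.2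
    simp only [Matrix.trace, Matrix.diag, powState, Matrix.of_apply, Fintype.sum_prod_type]
    simp only [← Finset.mul_sum, hr', mul_one]
    classical
    rw [← Fintype.piFinset_univ, ← Finset.prod_univ_sum
      (t := fun _ : Fin M => (Finset.univ : Finset A')) (f := fun _ b => p b b)]
    simp [hp']

variable {A B C A' A'' B' B'' : Type u} {M₁ M₂ : ℕ}

/-- The receiver's state after the transmission of the messages `m₁`, `m₂`: `ρ` on
`C A'_{m₁} A'' B'_{m₂} B''`, in tensor product with `p` or `q` on every other copy of `A'` or `B'`. -/
noncomputable def posReceived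
    (ρ : Matrix (C × ((A' × A'') × (B' × B''))) (C × ((A' × A'') × (B' × B''))) ℂ)
    (p : Matrix A' A' ℂ) (q : Matrix B' B' ℂ) (m₁ : Fin M₁) (m₂ : Fin M₂) :
    Matrix (C × (((Fin M₁ → A') × A'') × ((Fin M₂ → B') × B'')))
      (C × (((Fin M₁ → A') × A'') × ((Fin M₂ → B') × B''))) ℂ :=
  Matrix.of fun x y =>
    ρ (x.1, ((x.2.1.1 m₁, x.2.1.2), (x.2.2.1 m₂, x.2.2.2)))
      (y.1, ((y.2.1.1 m₁, y.2.1.2), (y.2.2.1 m₂, y.2.2.2))) *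
    ((∏ j, if j = m₁ then 1 else p (x.2.1.1 j) (y.2.1.1 j)) *
      ∏ j, if j = m₂ then 1 else q (x.2.2.1 j) (y.2.2.1 j))

/-- The channel acts on the registers at the positions `m₁`, `m₂` only, so the factors at the other
positions are scalars in each entry and pass through it. -/
theorem applyFst_posState (N : Matrix (A × B) (A × B) ℂ →ₗ[ℂ] Matrix C C ℂ)
    (α : Matrix (A × (A' × A'')) (A × (A' × A'')) ℂ)
    (β : Matrix (B × (B' × B'')) (B × (B' × B'')) ℂ)
    (p : Matrix A' A' ℂ) (q : Matrix B' B' ℂ) (m₁ : Fin M₁) (m₂ : Fin M₂) :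
    applyFst N (Matrix.reindex (Equiv.prodProdProdComm _ _ _ _) (Equiv.prodProdProdComm _ _ _ _)
      (posState α p m₁ ⊗ₖ posState β q m₂)) =
    posReceived (applyFst N (rearrange (α ⊗ₖ β))) p q m₁ m₂ := by
  ext ⟨c, ⟨f, x⟩, ⟨g, y⟩⟩ ⟨c', ⟨f', x'⟩, ⟨g', y'⟩⟩
  simp only [posReceived, applyFst, Matrix.of_apply, rearrange]
  rw [mul_comm (N _ c c'), ← smul_eq_mul, ← Matrix.smul_apply, ← map_smul]
  refine congrFun (congrFun (congrArg N ?_) c) c'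
  ext ⟨a, b⟩ ⟨a', b'⟩
  simp only [Matrix.of_apply, Matrix.reindex_apply, Matrix.submatrix_apply, Matrix.smul_apply,
    Equiv.prodProdProdComm_symm, Equiv.prodProdProdComm_apply, Matrix.kronecker_apply, posState,
    smul_eq_mul]
  ring

/-- The receiver's registers, split into `A'_i C A'' B''` and the remaining copies. -/
def splitFst (i : Fin M₁) : C × (((Fin M₁ → A') × A'') × ((Fin M₂ → B') × B'')) ≃
    (A' × (C × A'' × B'')) × (({j // j ≠ i} → A') × (Fin M₂ → B')) where
  toFun x := ((x.2.1.1 i, (x.1, x.2.1.2, x.2.2.2)), (fun j => x.2.1.1 j, x.2.2.1))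
  invFun z := (z.1.2.1, (((Equiv.funSplitAt i A').symm (z.1.1, z.2.1), z.1.2.2.1),
    (z.2.2, z.1.2.2.2)))
  left_inv x := by
    have := (Equiv.funSplitAt i A').symm_apply_apply x.2.1.1
    ext1
    · rfl
    · exact Prod.ext (Prod.ext this rfl) rfl
  right_inv z := by
    have := (Equiv.funSplitAt i A').apply_symm_apply (z.1.1, z.2.1)
    exact Prod.ext (Prod.ext (congrArg (fun t => t.1) this) rfl)
      (Prod.ext (congrArg (fun t => t.2) this) rfl)

/-- The receiver's registers, split into `B'_i C A'' B''` and the remaining copies. -/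
def splitSnd (i : Fin M₂) : C × (((Fin M₁ → A') × A'') × ((Fin M₂ → B') × B'')) ≃
    (B' × (C × A'' × B'')) × (({j // j ≠ i} → B') × (Fin M₁ → A')) where
  toFun x := ((x.2.2.1 i, (x.1, x.2.1.2, x.2.2.2)), (fun j => x.2.2.1 j, x.2.1.1))
  invFun z := (z.1.2.1, ((z.2.2, z.1.2.2.1),
    ((Equiv.funSplitAt i B').symm (z.1.1, z.2.1), z.1.2.2.2)))
  left_inv x := by
    have := (Equiv.funSplitAt i B').symm_apply_apply x.2.2.1
    exact Prod.ext rfl (Prod.ext rfl (Prod.ext this rfl))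
  right_inv z := by
    have := (Equiv.funSplitAt i B').apply_symm_apply (z.1.1, z.2.1)
    exact Prod.ext (Prod.ext (congrArg (fun t => t.1) this) rfl)
      (Prod.ext (congrArg (fun t => t.2) this) rfl)

/-- A test at the position `i` of the first round sees `ρ_{A'CA''B''}` if `i` is the message, and
`p ⊗ ρ_{CA''B''}` otherwise. -/
theorem marginal_splitFst_posReceived [Fintype A'] [Fintype B']
    (ρ : Matrix (C × ((A' × A'') × (B' × B''))) (C × ((A' × A'') × (B' × B''))) ℂ)
    {p : Matrix A' A' ℂ} {q : Matrix B' B' ℂ} (hp : p.trace = 1) (hq : q.trace = 1)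
    (i m₁ : Fin M₁) (m₂ : Fin M₂) :
    marginal (fun y r => (splitFst i).symm (y, r)) (posReceived ρ p q m₁ m₂) =
      if i = m₁ then marg₁ ρ else p ⊗ₖ margSnd (marg₁ ρ) := by
  ext ⟨a, c, x, y⟩ ⟨a', c', x', y'⟩
  have hB : ∀ h : B' → ℂ, _ := sum_copies hq m₂
  have hA := sum_other_copies hp i m₁
    (fun b b' => marg₁ ρ (b, (c, x, y)) (b', (c', x', y'))) a a'
  have e : (if i = m₁ then marg₁ ρ else p ⊗ₖ margSnd (marg₁ ρ)) (a, c, x, y) (a', c', x', y') =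
      if i = m₁ then marg₁ ρ (a, c, x, y) (a', c', x', y') else
        p a a' * ∑ b, marg₁ ρ (b, c, x, y) (b, c', x', y') := by
    split_ifs <;> rfl
  rw [e, ← hA]
  simp only [marginal, Matrix.of_apply, Fintype.sum_prod_type, posReceived, splitFst,
    Equiv.coe_fn_symm_mk, marg₁]
  refine Finset.sum_congr rfl fun r _ => ?_
  rw [← hB, Finset.sum_mul]
  refine Finset.sum_congr rfl fun g _ => ?_
  ring

/-- A test at the position `i` of the second round sees `ρ_{B'CA''B''}` if `i` is the message, and
`q ⊗ ρ_{CA''B''}` otherwise. -/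
theorem marginal_splitSnd_posReceived [Fintype A'] [Fintype B']
    (ρ : Matrix (C × ((A' × A'') × (B' × B''))) (C × ((A' × A'') × (B' × B''))) ℂ)
    {p : Matrix A' A' ℂ} {q : Matrix B' B' ℂ} (hp : p.trace = 1) (hq : q.trace = 1)
    (m₁ : Fin M₁) (i m₂ : Fin M₂) :
    marginal (fun y r => (splitSnd i).symm (y, r)) (posReceived ρ p q m₁ m₂) =
      if i = m₂ then marg₂ ρ else q ⊗ₖ margSnd (marg₂ ρ) := by
  ext ⟨a, c, x, y⟩ ⟨a', c', x', y'⟩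
  have hA : ∀ h : A' → ℂ, _ := sum_copies hp m₁
  have hB := sum_other_copies hq i m₂
    (fun b b' => marg₂ ρ (b, (c, x, y)) (b', (c', x', y'))) a a'
  have e : (if i = m₂ then marg₂ ρ else q ⊗ₖ margSnd (marg₂ ρ)) (a, c, x, y) (a', c', x', y') =
      if i = m₂ then marg₂ ρ (a, c, x, y) (a', c', x', y') else
        q a a' * ∑ b, marg₂ ρ (b, c, x, y) (b, c', x', y') := by
    split_ifs <;> rfl
  rw [e, ← hB]
  simp only [marginal, Matrix.of_apply, Fintype.sum_prod_type, posReceived, splitSnd,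
    Equiv.coe_fn_symm_mk, marg₂]
  refine Finset.sum_congr rfl fun r _ => ?_
  rw [← hA, Finset.sum_mul]
  refine Finset.sum_congr rfl fun g _ => ?_
  ring

theorem posTest₁_eq_onFactor {J : Type u} [DecidableEq A'] [DecidableEq B']
    (T : Matrix ((A' × (C × A'' × B'')) × J) ((A' × (C × A'' × B'')) × J) ℂ) (i : Fin M₁) :
    posTest₁ (M₂ := M₂) T i = onFactor (splitFst (B' := B') (M₂ := M₂) i) T := by
  ext ⟨⟨c, ⟨f, x⟩, ⟨g, y⟩⟩, j⟩ ⟨⟨c', ⟨f', x'⟩, ⟨g', y'⟩⟩, j'⟩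
  simp [posTest₁, onFactor, splitFst, Matrix.one_apply, funext_iff]

theorem posTest₂_eq_onFactor {J : Type u} [DecidableEq A'] [DecidableEq B']
    (T : Matrix ((B' × (C × A'' × B'')) × J) ((B' × (C × A'' × B'')) × J) ℂ) (i : Fin M₂) :
    posTest₂ (M₁ := M₁) T i = onFactor (splitSnd (A' := A') (M₁ := M₁) i) T := by
  ext ⟨⟨c, ⟨f, x⟩, ⟨g, y⟩⟩, j⟩ ⟨⟨c', ⟨f', x'⟩, ⟨g', y'⟩⟩, j'⟩
  simp [posTest₂, onFactor, splitSnd, Matrix.one_apply, funext_iff, and_comm]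

end Position

/-! ### Reduced states of the transmitted state -/

theorem IsChannel.margSnd_applyFst {X : Type u} {Y : Type v} {Z : Type w} [Fintype X] [Fintype Y]
    {N : Matrix X X ℂ →ₗ[ℂ] Matrix Y Y ℂ} (hN : IsChannel N)
    (ρ : Matrix (X × Z) (X × Z) ℂ) : margSnd (applyFst N ρ) = margSnd ρ := by
  ext z z'
  exact hN.tracePreserving (Matrix.of fun x x' => ρ (x, z) (x', z'))

theorem trace_reindex {X Y : Type*} [Fintype X] [Fintype Y] (e : X ≃ Y) (ρ : Matrix X X ℂ) :
    (Matrix.reindex e e ρ).trace = ρ.trace :=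
  e.symm.sum_comp fun x => ρ x x

theorem margFst_marg₁ {C A' A'' B' B'' : Type u} [Fintype C] [Fintype A''] [Fintype B']
    [Fintype B''] (ρ : Matrix (C × ((A' × A'') × (B' × B''))) (C × ((A' × A'') × (B' × B''))) ℂ) :
    margFst (marg₁ ρ) = margFst (margFst (margSnd ρ)) := by
  ext a a'
  have h := Fintype.sum_equiv
    (⟨fun z => (z.2.1, z.2.2.2, z.2.2.1, z.1), fun z => (z.2.2.2, z.1, z.2.2.1, z.2.1),
      fun _ => rfl, fun _ => rfl⟩ : C × A'' × B'' × B' ≃ A'' × B' × B'' × C)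
    (fun z => ρ (z.1, ((a, z.2.1), (z.2.2.2, z.2.2.1))) (z.1, ((a', z.2.1), (z.2.2.2, z.2.2.1))))
    (fun z => ρ (z.2.2.2, ((a, z.1), (z.2.1, z.2.2.1))) (z.2.2.2, ((a', z.1), (z.2.1, z.2.2.1))))
    (fun _ => rfl)
  simpa only [margFst, margSnd, marg₁, marginal, Matrix.of_apply, Fintype.sum_prod_type] using h

theorem margFst_marg₂ {C A' A'' B' B'' : Type u} [Fintype C] [Fintype A'] [Fintype A'']
    [Fintype B''] (ρ : Matrix (C × ((A' × A'') × (B' × B''))) (C × ((A' × A'') × (B' × B''))) ℂ) :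
    margFst (marg₂ ρ) = margFst (margSnd (margSnd ρ)) := by
  ext a a'
  have h := Fintype.sum_equiv
    (⟨fun z => (z.2.2.1, z.2.2.2, z.2.1, z.1), fun z => (z.2.2.2, z.2.2.1, z.1, z.2.1),
      fun _ => rfl, fun _ => rfl⟩ : C × A'' × B'' × A' ≃ B'' × A' × A'' × C)
    (fun z => ρ (z.1, ((z.2.2.2, z.2.1), (a, z.2.2.1))) (z.1, ((z.2.2.2, z.2.1), (a', z.2.2.1))))
    (fun z => ρ (z.2.2.2, ((z.2.1, z.2.2.1), (a, z.1))) (z.2.2.2, ((z.2.1, z.2.2.1), (a', z.1))))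
    (fun _ => rfl)
  simpa only [margFst, margSnd, marg₂, marginal, Matrix.of_apply, Fintype.sum_prod_type] using h

theorem margSnd_rearrange_kronecker {A B A' A'' B' B'' : Type u} [Fintype A] [Fintype B]
    (α : Matrix (A × (A' × A'')) (A × (A' × A'')) ℂ)
    (β : Matrix (B × (B' × B'')) (B × (B' × B'')) ℂ) :
    margSnd (rearrange (α ⊗ₖ β)) = margSnd α ⊗ₖ margSnd β := by
  ext ⟨⟨a, x⟩, ⟨b, y⟩⟩ ⟨⟨a', x'⟩, ⟨b', y'⟩⟩
  simp [margSnd, marginal, rearrange, Fintype.sum_prod_type, Finset.sum_mul_sum]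

theorem IsState.margFst {Y Z : Type*} [Fintype Y] [Fintype Z] {ρ : Matrix (Y × Z) (Y × Z) ℂ}
    (hρ : IsState ρ) : IsState (margFst ρ) :=
  ⟨posSemidef_marginal _ hρ.1, (trace_margFst ρ).trans hρ.2⟩

theorem IsState.margSnd {Y Z : Type*} [Fintype Y] [Fintype Z] {ρ : Matrix (Y × Z) (Y × Z) ℂ}
    (hρ : IsState ρ) : IsState (margSnd ρ) :=
  ⟨posSemidef_marginal _ hρ.1, (trace_margSnd ρ).trans hρ.2⟩

/-! ### Tests from the hypothesis testing divergence -/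

/-- If the rate `R` is at most `D_H^ε(ρ ‖ σ) - log (1/δ)`, some test accepts `ρ` up to the error `ε`
and has a total error at most `δ` when applied to `⌊2 ^ R⌋ - 1` copies of `σ`. Since
`⌊2 ^ R⌋ - 1 / 2 < 2 ^ R`, a test whose value is close to the supremum is enough, and it does not
matter whether the supremum is attained. -/
theorem exists_test {X : Type*} [Fintype X] [DecidableEq X] {ε δ R : ℝ} (hδ : 0 < δ) (hR : 0 ≤ R)
    {ρ σ : Matrix X X ℂ}
    (h : (R : EReal) ≤ hypTestDiv ε ρ σ - ((Real.logb 2 (1 / δ) : ℝ) : EReal)) :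
    ∃ Λ : Matrix X X ℂ, Λ.PosSemidef ∧ (1 - Λ).PosSemidef ∧ 1 - ε ≤ (Λ * ρ).trace.re ∧
      ((⌊(2 : ℝ) ^ R⌋₊ : ℝ) - 1) * (Λ * σ).trace.re ≤ δ := by
  set M : ℝ := (⌊(2 : ℝ) ^ R⌋₊ : ℝ) with hM
  have hM1 : 1 ≤ M := by
    have : (1 : ℝ) ≤ 2 ^ R := Real.one_le_rpow (by norm_num) hR
    rw [hM]
    exact_mod_cast Nat.le_floor (by exact_mod_cast this)
  have hM2 : M ≤ 2 ^ R := Nat.floor_le (by positivity)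
  have hpos : 0 < (M - 1 / 2) / δ := div_pos (by linarith) hδ
  have hlt : Real.logb 2 ((M - 1 / 2) / δ) < R + Real.logb 2 (1 / δ) := by
    have h2 : R + Real.logb 2 (1 / δ) = Real.logb 2 (2 ^ R * (1 / δ)) := by
      rw [Real.logb_mul (by positivity) (by positivity), Real.logb_rpow (by norm_num) (by norm_num)]
    rw [h2]
    apply Real.logb_lt_logb (by norm_num) hpos
    rw [mul_one_div]
    exact div_lt_div_of_pos_right (by linarith) hδ
  have h1 : ((R + Real.logb 2 (1 / δ) : ℝ) : EReal) ≤ hypTestDiv ε ρ σ := by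
    rw [EReal.coe_add]
    exact (EReal.le_sub_iff_add_le (.inl (EReal.coe_ne_bot _)) (.inl (EReal.coe_ne_top _))).1 h
  have h3 : ((Real.logb 2 ((M - 1 / 2) / δ) : ℝ) : EReal) < hypTestDiv ε ρ σ :=
    lt_of_lt_of_le (EReal.coe_lt_coe_iff.2 hlt) h1
  simp only [hypTestDiv, lt_iSup_iff] at h3
  obtain ⟨Λ, ⟨hΛ0, hΛ1, hΛε⟩, hΛ⟩ := h3
  refine ⟨Λ, hΛ0, hΛ1, hΛε, ?_⟩
  generalize (Λ * σ).trace.re = t at hΛ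
  unfold logInv at hΛ
  by_cases ht : t ≤ 0
  · exact (mul_nonpos_of_nonneg_of_nonpos (by linarith) ht).trans hδ.le
  · push Not at ht
    rw [if_neg (not_le.2 ht), EReal.coe_lt_coe_iff,
      Real.logb_lt_logb_iff (by norm_num) hpos (by positivity), div_lt_div_iff₀ hδ ht] at hΛ
    linarith

/-! ### The code -/

/-- The errors of the tests of one round of the sequential decoder add up to at most `ε + δ`. -/
theorem sum_test_errors_le {M : ℕ} (m : Fin M) {F : Fin M → ℝ} {ε δ t : ℝ} (hm : F m ≤ ε)
    (hF : ∀ i, i ≠ m → F i ≤ t) (ht : ((M : ℝ) - 1) * t ≤ δ) : ∑ i, F i ≤ ε + δ := by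
  rw [← Finset.add_sum_erase _ _ (Finset.mem_univ m)]
  refine add_le_add hm (le_trans ?_ ht)
  refine (Finset.sum_le_card_nsmul _ _ t fun i hi => hF i (Finset.ne_of_mem_erase hi)).trans ?_
  rw [Finset.card_erase_of_mem (Finset.mem_univ m), Finset.card_fin, nsmul_eq_mul,
    Nat.cast_sub (Fin.pos m), Nat.cast_one]

/-- The position-based code with the sequential decoder built from two tests `Λ₁`, `Λ₂`. Its error is
controlled by the errors of the tests on `ρ` and on the products of the marginals. -/
theorem exists_positionBased_code {A B C A' A'' B' B'' : Type u}
    [Fintype A] [Fintype B] [Fintype C] [DecidableEq C]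
    [Fintype A'] [DecidableEq A'] [Fintype A''] [DecidableEq A'']
    [Fintype B'] [DecidableEq B'] [Fintype B''] [DecidableEq B'']
    {N : Matrix (A × B) (A × B) ℂ →ₗ[ℂ] Matrix C C ℂ} (hN : IsChannel N)
    {α : Matrix (A × (A' × A'')) (A × (A' × A'')) ℂ}
    {β : Matrix (B × (B' × B'')) (B × (B' × B'')) ℂ} (hα : IsState α) (hβ : IsState β)
    {p : Matrix A' A' ℂ} {r : Matrix A'' A'' ℂ} {q : Matrix B' B' ℂ} {t : Matrix B'' B'' ℂ}
    (hp : IsState p) (hr : IsState r) (hq : IsState q) (ht : IsState t)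
    (hαp : margSnd α = p ⊗ₖ r) (hβq : margSnd β = q ⊗ₖ t)
    {ρ : Matrix (C × ((A' × A'') × (B' × B''))) (C × ((A' × A'') × (B' × B''))) ℂ}
    (hρ : ρ = applyFst N (rearrange (α ⊗ₖ β))) {M₁ M₂ : ℕ} (d₁ : Fin M₁) (d₂ : Fin M₂)
    {ε₁ ε₂ δ : ℝ} {Λ₁ : Matrix (A' × (C × A'' × B'')) (A' × (C × A'' × B'')) ℂ}
    {Λ₂ : Matrix (B' × (C × A'' × B'')) (B' × (C × A'' × B'')) ℂ}
    (hΛ₁0 : Λ₁.PosSemidef) (hΛ₁1 : (1 - Λ₁).PosSemidef) (hΛ₂0 : Λ₂.PosSemidef)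
    (hΛ₂1 : (1 - Λ₂).PosSemidef)
    (hΛ₁ε : 1 - ε₁ ≤ (Λ₁ * marg₁ ρ).trace.re) (hΛ₂ε : 1 - ε₂ ≤ (Λ₂ * marg₂ ρ).trace.re)
    (hΛ₁δ : ((M₁ : ℝ) - 1) * (Λ₁ * (p ⊗ₖ margSnd (marg₁ ρ))).trace.re ≤ δ)
    (hΛ₂δ : ((M₂ : ℝ) - 1) * (Λ₂ * (q ⊗ₖ margSnd (marg₂ ρ))).trace.re ≤ δ) :
    ∃ code : EACode A B C M₁ M₂,
      code.HasErrors N (4 * (ε₁ + ε₂ + 2 * δ)) (4 * (ε₁ + ε₂ + 2 * δ)) ∧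
      (∀ m, code.jointError N m ≤ 4 * (ε₁ + ε₂ + 2 * δ)) ∧
      code.IsSequentialPositionBased A' A'' B' B'' := by
  -- a trace of `1` excludes empty registers
  have hnonempty : ∀ {X Y : Type u} [Fintype X] [Fintype Y] {ω : Matrix (X × Y) (X × Y) ℂ},
      IsState ω → Nonempty X := by
    intro X Y _ _ ω hω
    by_contra h
    rw [not_nonempty_iff] at h
    have := hω.2
    simp [Matrix.trace] at this
  have := hnonempty hα
  have := hnonempty hβ
  obtain ⟨θ₁, enc₁, hθ₁, henc₁, hω₁⟩ := exists_encoder (M := M₁)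
    (isState_powState M₁ hp hr) (posSemidef_posState hα.1 hp.1)
    (margSnd_posState hαp)
  obtain ⟨θ₂, enc₂, hθ₂, henc₂, hω₂⟩ := exists_encoder (M := M₂)
    (isState_powState M₂ hq ht) (posSemidef_posState hβ.1 hq.1)
    (margSnd_posState hβq)
  obtain ⟨T₁, hT₁, hT₁Λ⟩ := exists_naimark hΛ₁0 hΛ₁1
  obtain ⟨T₂, hT₂, hT₂Λ⟩ := exists_naimark hΛ₂0 hΛ₂1
  have hP : ∀ i, IsStarProjection (posTest₁ (B' := B') (M₁ := M₁) (M₂ := M₂) T₁ i) := fun i => by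
    rw [posTest₁_eq_onFactor]; exact isStarProjection_onFactor _ hT₁
  have hQ : ∀ i, IsStarProjection (posTest₂ (A' := A') (M₁ := M₁) (M₂ := M₂) T₂ i) := fun i => by
    rw [posTest₂_eq_onFactor]; exact isStarProjection_onFactor _ hT₂
  obtain ⟨dec, hdec, hdec_eq⟩ := exists_isChannel_seqDecode none hP hQ d₁ d₂
  let code : EACode A B C M₁ M₂ :=
    { EA := (Fin M₁ → A') × A''
      EC₁ := (Fin M₁ → A') × A''
      EB := (Fin M₂ → B') × B''
      EC₂ := (Fin M₂ → B') × B''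
      fintypeEA := inferInstance
      fintypeEC₁ := inferInstance
      fintypeEB := inferInstance
      fintypeEC₂ := inferInstance
      θ₁ := θ₁
      θ₂ := θ₂
      θ₁_unit := hθ₁
      θ₂_unit := hθ₂
      enc₁ := enc₁
      enc₂ := enc₂
      dec := dec
      enc₁_channel := henc₁
      enc₂_channel := henc₂
      dec_channel := hdec }
  have hreceived : ∀ m, code.received N m = posReceived ρ p q m.1 m.2 := by
    intro m
    rw [hρ, ← applyFst_posState, ← hω₁, ← hω₂]
    rfl
  have hpsd : ∀ m : Fin M₁ × Fin M₂, (posReceived ρ p q m.1 m.2).PosSemidef := by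
    intro m
    rw [hρ, ← applyFst_posState]
    exact hN.posSemidef_applyFst (((posSemidef_posState hα.1 hp.1 _).kronecker
      (posSemidef_posState hβ.1 hq.1 _)).submatrix _)
  have htrace : ∀ m : Fin M₁ × Fin M₂, (posReceived ρ p q m.1 m.2).trace = 1 := by
    intro m
    rw [hρ, ← applyFst_posState, hN.trace_applyFst, trace_reindex, Matrix.trace_kronecker,
      ← trace_margSnd (posState α p m.1), margSnd_posState hαp,
      ← trace_margSnd (posState β q m.2), margSnd_posState hβq,
      (isState_powState M₁ hp hr).2, (isState_powState M₂ hq ht).2, mul_one]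
  have hprob : ∀ m m', code.outcomeProb N m m' =
      (seqDecode none (posTest₁ T₁) (posTest₂ T₂) d₁ d₂
        (posReceived ρ p q m.1 m.2) m' m').re := by
    intro m m'
    rw [← hdec_eq, ← hreceived]
    rfl
  have hprob_nonneg : ∀ m m', 0 ≤ code.outcomeProb N m m' := by
    intro m m'
    rw [hprob]
    exact seqDecode_apply_nonneg _ _ _ _ _ (hpsd m) m'
  have hsuccess : ∀ m, 1 - 4 * (ε₁ + ε₂ + 2 * δ) ≤ code.outcomeProb N m m := by
    intro m
    have h := le_seqDecode_apply none hP hQ d₁ d₂ (hpsd m) m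
    rw [htrace, ← hprob] at h
    have hv₁ : ∀ i, (posTest₁ T₁ i * (posReceived ρ p q m.1 m.2 ⊗ₖ
        Matrix.single (none : Option PUnit.{u + 1}) none (1 : ℂ))).trace =
        (Λ₁ * if i = m.1 then marg₁ ρ else p ⊗ₖ margSnd (marg₁ ρ)).trace := by
      intro i
      rw [posTest₁_eq_onFactor, trace_onFactor_mul, hT₁Λ,
        marginal_splitFst_posReceived ρ hp.2 hq.2]
    have hv₂ : ∀ i, (posTest₂ T₂ i * (posReceived ρ p q m.1 m.2 ⊗ₖ
        Matrix.single (none : Option PUnit.{u + 1}) none (1 : ℂ))).trace =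
        (Λ₂ * if i = m.2 then marg₂ ρ else q ⊗ₖ margSnd (marg₂ ρ)).trace := by
      intro i
      rw [posTest₂_eq_onFactor, trace_onFactor_mul, hT₂Λ,
        marginal_splitSnd_posReceived ρ hp.2 hq.2]
    simp only [hv₁, hv₂, Complex.one_re] at h
    have h₁ := sum_test_errors_le m.1 (ε := ε₁) (F := fun i => if i = m.1 then
      1 - (Λ₁ * if i = m.1 then marg₁ ρ else p ⊗ₖ margSnd (marg₁ ρ)).trace.re else
      (Λ₁ * if i = m.1 then marg₁ ρ else p ⊗ₖ margSnd (marg₁ ρ)).trace.re)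
      (by simp only [if_true]; linarith) (fun i hi => by simp only [if_neg hi, le_refl]) hΛ₁δ
    have h₂ := sum_test_errors_le m.2 (ε := ε₂) (F := fun i => if i = m.2 then
      1 - (Λ₂ * if i = m.2 then marg₂ ρ else q ⊗ₖ margSnd (marg₂ ρ)).trace.re else
      (Λ₂ * if i = m.2 then marg₂ ρ else q ⊗ₖ margSnd (marg₂ ρ)).trace.re)
      (by simp only [if_true]; linarith) (fun i hi => by simp only [if_neg hi, le_refl]) hΛ₂δ
    linarith
  -- the joint error is the complement of the success probability, as the decoder preserves the trace
  have htotal : ∀ m, ∑ m', code.outcomeProb N m m' = 1 := by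
    intro m
    have h := hdec.tracePreserving (posReceived ρ p q m.1 m.2)
    rw [htrace, hdec_eq] at h
    simp only [hprob, ← Complex.re_sum]
    exact congrArg Complex.re h
  have hjoint : ∀ m, code.jointError N m ≤ 4 * (ε₁ + ε₂ + 2 * δ) := by
    intro m
    have h := htotal m
    rw [← Finset.sum_erase_add _ _ (Finset.mem_univ m)] at h
    have h' := hsuccess m
    have e : code.jointError N m = ∑ m' ∈ Finset.univ.erase m, code.outcomeProb N m m' := by
      unfold EACode.jointError
      congr 1
      ext m'
      simp
    linarith
  refine ⟨code, fun m => ⟨le_trans ?_ (hjoint m), le_trans ?_ (hjoint m)⟩, hjoint, ?_⟩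
  · refine Finset.sum_le_sum_of_subset_of_nonneg (fun m' hm' => ?_) fun m' _ _ => hprob_nonneg m m'
    simp only [Finset.mem_filter, Finset.mem_univ, true_and] at hm' ⊢
    exact fun h => hm' (congrArg Prod.fst h)
  · refine Finset.sum_le_sum_of_subset_of_nonneg (fun m' hm' => ?_) fun m' _ _ => hprob_nonneg m m'
    simp only [Finset.mem_filter, Finset.mem_univ, true_and] at hm' ⊢
    exact fun h => hm' (congrArg Prod.snd h)
  · exact ⟨Equiv.refl _, Equiv.refl _, Option PUnit.{u + 1}, inferInstance, inferInstance, none,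
      T₁, T₂, d₁, d₂, hT₁, hT₂, hdec_eq⟩

end QMAC

theorem theorem10 {A B C A' A'' B' B'' : Type u}
    [Fintype A] [DecidableEq A] [Fintype B] [DecidableEq B] [Fintype C] [DecidableEq C]
    [Fintype A'] [DecidableEq A'] [Fintype A''] [DecidableEq A'']
    [Fintype B'] [DecidableEq B'] [Fintype B''] [DecidableEq B'']
    (N : Matrix (A × B) (A × B) ℂ →ₗ[ℂ] Matrix C C ℂ) (hN : QMAC.IsChannel N)
    (ε₁ ε₂ δ : ℝ) (hε₁ : ε₁ ∈ Set.Ioo (0 : ℝ) 1) (hε₂ : ε₂ ∈ Set.Ioo (0 : ℝ) 1)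
    (hδ : δ ∈ Set.Ioo (0 : ℝ) 1)
    (ψ : Matrix ((A × (A' × A'')) × (B × (B' × B''))) ((A × (A' × A'')) × (B × (B' × B''))) ℂ)
    (hψ : QMAC.IsState ψ)
    (hprod : ψ = QMAC.margFst ψ ⊗ₖ QMAC.margSnd ψ)
    (hind : QMAC.MutuallyIndependent (QMAC.margSnd (QMAC.rearrange ψ)))
    (ρ : Matrix (C × ((A' × A'') × (B' × B''))) (C × ((A' × A'') × (B' × B''))) ℂ)
    (hρ : ρ = QMAC.applyFst N (QMAC.rearrange ψ))
    (R₁ R₂ : ℝ) (hR₁_nonneg : 0 ≤ R₁) (hR₂_nonneg : 0 ≤ R₂)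
    (hR₁ : (R₁ : EReal) ≤
      QMAC.hypTestDiv ε₁ (QMAC.marg₁ ρ)
          (QMAC.margFst (QMAC.marg₁ ρ) ⊗ₖ QMAC.margSnd (QMAC.marg₁ ρ)) -
        ((Real.logb 2 (1 / δ) : ℝ) : EReal))
    (hR₂ : (R₂ : EReal) ≤
      QMAC.hypTestDiv ε₂ (QMAC.marg₂ ρ)
          (QMAC.margFst (QMAC.marg₂ ρ) ⊗ₖ QMAC.margSnd (QMAC.marg₂ ρ)) -
        ((Real.logb 2 (1 / δ) : ℝ) : EReal)) :
    ∃ code : QMAC.EACode A B C ⌊(2 : ℝ) ^ R₁⌋₊ ⌊(2 : ℝ) ^ R₂⌋₊,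
      code.HasErrors N (4 * (ε₁ + ε₂ + 2 * δ)) (4 * (ε₁ + ε₂ + 2 * δ)) ∧
      (∀ m, code.jointError N m ≤ 4 * (ε₁ + ε₂ + 2 * δ)) ∧
      code.IsSequentialPositionBased A' A'' B' B'' := by
  obtain ⟨Λ₁, hΛ₁0, hΛ₁1, hΛ₁ε, hΛ₁δ⟩ := QMAC.exists_test hδ.1 hR₁_nonneg hR₁
  obtain ⟨Λ₂, hΛ₂0, hΛ₂1, hΛ₂ε, hΛ₂δ⟩ := QMAC.exists_test hδ.1 hR₂_nonneg hR₂
  -- `ψ = α ⊗ β`, and independence gives `α_{A'A''} = p ⊗ α_{A''}` and `β_{B'B''} = q ⊗ β_{B''}`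
  have hα : QMAC.IsState (QMAC.margFst ψ) := hψ.margFst
  have hβ : QMAC.IsState (QMAC.margSnd ψ) := hψ.margSnd
  generalize QMAC.margFst ψ = α at hα hprod
  generalize QMAC.margSnd ψ = β at hβ hprod
  subst hprod
  have hαm := hα.margSnd
  have hβm := hβ.margSnd
  have hτ := QMAC.margSnd_rearrange_kronecker α β
  have hτ₁ : QMAC.margFst (QMAC.margSnd (QMAC.rearrange (α ⊗ₖ β))) = QMAC.margSnd α := by
    rw [hτ, QMAC.margFst_kronecker, hβm.2, one_smul]
  have hτ₂ : QMAC.margSnd (QMAC.margSnd (QMAC.rearrange (α ⊗ₖ β))) = QMAC.margSnd β := by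
    rw [hτ, QMAC.margSnd_kronecker, hαm.2, one_smul]
  set p := QMAC.margFst (QMAC.margSnd α)
  set q := QMAC.margFst (QMAC.margSnd β)
  have hp : QMAC.IsState p := hαm.margFst
  have hq : QMAC.IsState q := hβm.margFst
  have hp'' := hαm.margSnd
  have hq'' := hβm.margSnd
  unfold QMAC.MutuallyIndependent at hind
  rw [hτ₁, hτ₂, hτ] at hind
  have hαp : QMAC.margSnd α = p ⊗ₖ QMAC.margSnd (QMAC.margSnd α) := by
    have h := congrArg QMAC.margFst hind
    rwa [QMAC.margFst_kronecker, QMAC.margFst_kronecker, Matrix.trace_kronecker, hβm.2, hq.2,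
      hq''.2, one_mul, one_smul, one_smul] at h
  have hβq : QMAC.margSnd β = q ⊗ₖ QMAC.margSnd (QMAC.margSnd β) := by
    have h := congrArg QMAC.margSnd hind
    rwa [QMAC.margSnd_kronecker, QMAC.margSnd_kronecker, Matrix.trace_kronecker, hαm.2, hp.2,
      hp''.2, one_mul, one_smul, one_smul] at h
  -- `N` preserves the trace, so `ρ_{A'} = p` and `ρ_{B'} = q`
  have hρ₁ : QMAC.margFst (QMAC.marg₁ ρ) = p := by
    rw [QMAC.margFst_marg₁, hρ, hN.margSnd_applyFst, hτ₁]
  have hρ₂ : QMAC.margFst (QMAC.marg₂ ρ) = q := by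
    rw [QMAC.margFst_marg₂, hρ, hN.margSnd_applyFst, hτ₂]
  rw [hρ₁] at hΛ₁δ
  rw [hρ₂] at hΛ₂δ
  have hfloor : ∀ R : ℝ, 0 ≤ R → 0 < ⌊(2 : ℝ) ^ R⌋₊ := fun R hR =>
    Nat.floor_pos.2 (Real.one_le_rpow (by norm_num) hR)
  exact QMAC.exists_positionBased_code hN hα hβ hp hp'' hq hq'' hαp hβq hρ ⟨0, hfloor R₁ hR₁_nonneg⟩
    ⟨0, hfloor R₂ hR₂_nonneg⟩ hΛ₁0 hΛ₁1 hΛ₂0 hΛ₂1 hΛ₁ε hΛ₂ε hΛ₁δ hΛ₂δ
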